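/- Let $d\ge 1$ and let $\mathcal P=(p(i,j))_{i,j\in\mathbb Z^d}$ be a stochastic matrix that is homogeneous ($p(i,j)=p(0,j-i)=:p(j-i)$), centered ($\sum_j j\,p(j)=0$), of finite range ($p(j)=0$ for $|j|>v$, for some $v$) and truly $d$-dimensional ($\{j: p(j)\ne 0\}$ generates the group $\mathbb Z^d$). Let $(\varepsilon_n(i))_{n\in\mathbb Z,\,i\in\mathbb Z^d}$ be i.i.d. integrable symmetric real random variables that are not almost surely $0$, and write $\varepsilon_n=(\varepsilon_n(i))_{i\in\mathbb Z^d}$. The wall process is defined by $W_0\equiv 0$ and $W_n=(\mathcal P W_{n-1}+\varepsilon_n)^+$ for $n\ge 1$, where $(\mathcal P w)(i)=\sum_j p(i,j)w(j)$ and the positive part is taken at each site. The law of a random surface $Z=(Z(i))_{i\in\mathbb Z^d}$ is called an invariant measure if $Z$ and $(\mathcal P Z+\varepsilon_0)^+$ have the same law when $Z$ and $\varepsilon_0$ are independent. Then: (a) there is no nondegenerate invariant measure: no invariant measure exists on the surfaces with finite heights, and if heights in $[0,\infty]$ are allowed, then every invariant measure gives probability $1$ to the surface that is identically $\infty$; (b)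 $W_n\to\infty$ in probability: $\mathbb P(W_n(i)>M)\to 1$ as $n\to\infty$ for every $i\in\mathbb Z^d$ and every $M\in\mathbb R$; (c) $W_n(i)$ is integrable for all $n$ and $i$, and $\mu_n:=\mathbb E\,W_n(0)\to\infty$ as $n\to\infty$; (d) $\mu_n/n\to 0$ as $n\to\infty$. -/

import Mathlib

open MeasureTheory ProbabilityTheory Filter Topology

namespace SerialHarness

/-- The sites of the lattice `ℤ^d`. -/
abbrev Site (d : ℕ) : Type := Fin d → ℤ

/-- The averaging matrices: stochastic, homogeneous, centered, of finite range and truly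
`d`-dimensional matrices indexed by `ℤ^d`. -/
structure IsHarnessMatrix {d : ℕ} (P : Site d → Site d → ℝ) : Prop where
  nonneg : ∀ i j, 0 ≤ P i j
  row_sum : ∀ i, HasSum (fun j => P i j) 1
  homogeneous : ∀ i j, P i j = P 0 (j - i)
  finite_range : ∃ v : ℝ, ∀ j : Site d, v < ‖j‖ → P 0 j = 0
  centered : ∀ k : Fin d, ∑' j : Site d, P 0 j * (j k : ℝ) = 0
  generates : AddSubgroup.closure {j : Site d | P 0 j ≠ 0} = ⊤

/-- A space-time family of i.i.d. integrable symmetric real random variables. -/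
structure IsSymmetricNoise {d : ℕ} {Ω : Type*} [MeasurableSpace Ω] (μ : Measure Ω)
    (ε : ℤ → Site d → Ω → ℝ) : Prop where
  measurable : ∀ n i, Measurable (ε n i)
  indep : iIndepFun (fun k : ℤ × Site d => ε k.1 k.2) μ
  identDistrib : ∀ n i, IdentDistrib (ε n i) (ε 0 0) μ μ
  integrable : Integrable (ε 0 0) μ
  symmetric : IdentDistrib (fun ω => -ε 0 0 ω) (ε 0 0) μ μ

/-- One step of the wall dynamics, `(P z + e)⁺`. -/
noncomputable def wallStep {d : ℕ} (P : Site d → Site d → ℝ) (z e : Site d → ℝ) :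
    Site d → ℝ :=
  fun i => max (∑' j, P i j * z j + e i) 0

/-- The wall process `W n i ω` started from the flat surface at height zero. -/
noncomputable def wallProcess {d : ℕ} {Ω : Type*} (P : Site d → Site d → ℝ)
    (ε : ℤ → Site d → Ω → ℝ) : ℕ → Site d → Ω → ℝ
  | 0 => fun _ _ => 0
  | n + 1 => fun i ω =>
      wallStep P (fun j => wallProcess P ε n j ω) (fun j => ε ((n : ℤ) + 1) j ω) i

/-- The law of the noise configuration at one time. -/
noncomputable def noiseLaw {d : ℕ} {Ω : Type*} [MeasurableSpace Ω] (μ : Measure Ω)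
    (ε : ℤ → Site d → Ω → ℝ) : Measure (Site d → ℝ) :=
  μ.map (fun ω i => ε 0 i ω)

/-- `ν` is an invariant probability measure: if `Z` has law `ν`, `e` has law `κ` and they are
independent, then `(P Z + e)⁺` has law `ν`. Such a `ν` is carried by nonnegative surfaces. -/
def IsInvariantMeasure {d : ℕ} (P : Site d → Site d → ℝ) (κ ν : Measure (Site d → ℝ)) : Prop :=
  IsProbabilityMeasure ν ∧ (ν.prod κ).map (fun q => wallStep P q.1 q.2) = ν

/-- One step of the wall dynamics on surfaces whose heights may be infinite. With `a = (P z) i`,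
truncated subtraction gives `(a + e i)⁺ = (a + (e i)⁺) - (e i)⁻`, and `∞` when `a = ∞`. -/
noncomputable def extWallStep {d : ℕ} (P : Site d → Site d → ℝ) (z : Site d → ENNReal)
    (e : Site d → ℝ) : Site d → ENNReal :=
  fun i => ((∑' j, ENNReal.ofReal (P i j) * z j) + ENNReal.ofReal (e i)) - ENNReal.ofReal (-e i)

/-- Invariant probability measures on surfaces with heights in `[0, ∞]`. -/
def IsExtInvariantMeasure {d : ℕ} (P : Site d → Site d → ℝ) (κ : Measure (Site d → ℝ))
    (ν : Measure (Site d → ENNReal)) : Prop :=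
  IsProbabilityMeasure ν ∧ (ν.prod κ).map (fun q => extWallStep P q.1 q.2) = ν

end SerialHarness

/-! Write `surf` for the wall surface and `free` for the same dynamics without the wall. By
monotonicity and linearity, after `k` further steps the wall surface lies above the `k`-fold average
of its present state plus a free surface driven by fresh noise (`avg_iterate_add_free_le_surf`). The
free term is independent of the present, symmetric, and very negative with positive probability.

Means are unbounded: if they stayed below `C`, Markov's inequality would keep the averaged surface
below `2 * C` with probability at least 1/2. With a further fixed probability the fresh free surface
falls below `-(2 * C + 1)`, and then the wall gains at least one unit. Each block of `k` steps would
thus add a fixed amount to the mean (`exists_lt_integral_surf`).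

Large means give large heights: the `k`-step transition probabilities become uniformly small
(`exists_weight_le`), so averages of the truncated surface concentrate. Adding a free surface that
is nonnegative with probability at least 1/2, every level is exceeded at some time with probability
at least 1/3 (`exists_third_le_measureReal_surf`).

Seen at a fixed time, the surface increases as its starting time recedes. Its divergence is a tail
event of the noise, of probability at least 1/3, hence 1 (`ae_mem_blowUp`). Stationarity turns this
into (b). Increments of the mean are mean negative parts, which vanish by dominated convergence, and
Cesàro averaging gives (d). An invariant law stochastically dominates every `surf` started from zero
(`lintegral_surf_le`), which forces infinite heights and gives (a). -/

namespace SerialHarness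

/-! ### The averaging operator and the decay of its transition probabilities. -/

variable {d : ℕ} {P : Site d → Site d → ℝ}

/-- The averaged surface `P z`. -/
noncomputable def avg (P : Site d → Site d → ℝ) (z : Site d → ℝ) : Site d → ℝ :=
  fun i => ∑' j, P i j * z j

/-- The `k`-step transition probabilities from the origin. -/
noncomputable def weight (P : Site d → Site d → ℝ) (k : ℕ) (x : Site d) : ℝ :=
  (avg P)^[k] (fun y => if y = x then 1 else 0) 0

lemma weight_zero_zero : weight P 0 (0 : Site d) = 1 := by
  simp [weight]

lemma weight_one (P : Site d → Site d → ℝ) (x : Site d) : weight P 1 x = P 0 x := by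
  rw [weight, Function.iterate_one, avg, tsum_eq_single x (fun y hy => by simp [hy])]
  simp

namespace IsHarnessMatrix

lemma apply_add (hP : IsHarnessMatrix P) (i x : Site d) : P i (i + x) = P 0 x := by
  rw [hP.homogeneous, add_sub_cancel_left]

lemma exists_range (hP : IsHarnessMatrix P) :
    ∃ R : ℕ, ∀ x : Site d, P 0 x ≠ 0 → ‖x‖ ≤ R := by
  obtain ⟨v, hv⟩ := hP.finite_range
  obtain ⟨R, hR⟩ := exists_nat_ge v
  refine ⟨R, fun x hx => ?_⟩
  by_contra! h
  exact hx (hv x (hR.trans_lt h))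

lemma finite_support (hP : IsHarnessMatrix P) : {x : Site d | P 0 x ≠ 0}.Finite := by
  obtain ⟨R, hR⟩ := hP.exists_range
  exact ((isCompact_closedBall (0 : Site d) (R : ℝ)).finite_of_discrete).subset
    fun x hx => by simpa using hR x hx

/-- The finite set of possible steps. -/
noncomputable def steps (hP : IsHarnessMatrix P) : Finset (Site d) := hP.finite_support.toFinset

lemma mem_steps (hP : IsHarnessMatrix P) {x : Site d} : x ∈ hP.steps ↔ P 0 x ≠ 0 := by
  simp [steps]

lemma avg_eq_sum (hP : IsHarnessMatrix P) (z : Site d → ℝ) (i : Site d) :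
    avg P z i = ∑ x ∈ hP.steps, P 0 x * z (i + x) := by
  unfold avg
  rw [← (Equiv.addLeft i).tsum_eq, tsum_eq_sum (s := hP.steps)]
  · simp [hP.apply_add]
  · intro x hx
    have : P 0 x = 0 := by simpa [hP.mem_steps] using hx
    simp [hP.apply_add, this]

lemma sum_steps (hP : IsHarnessMatrix P) : ∑ x ∈ hP.steps, P 0 x = 1 := by
  rw [← (hP.row_sum 0).tsum_eq, tsum_eq_sum (s := hP.steps)]
  intro x hx
  simpa [hP.mem_steps] using hx

lemma avg_mono (hP : IsHarnessMatrix P) {z w : Site d → ℝ} (h : ∀ i, z i ≤ w i) (i : Site d) :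
    avg P z i ≤ avg P w i := by
  rw [hP.avg_eq_sum, hP.avg_eq_sum]
  exact Finset.sum_le_sum fun x _ => mul_le_mul_of_nonneg_left (h _) (hP.nonneg _ _)

lemma avg_add (hP : IsHarnessMatrix P) (z w : Site d → ℝ) :
    avg P (z + w) = avg P z + avg P w := by
  ext i
  simp [hP.avg_eq_sum, mul_add, Finset.sum_add_distrib]

lemma avg_neg (hP : IsHarnessMatrix P) (z : Site d → ℝ) : avg P (-z) = -avg P z := by
  ext i
  simp [hP.avg_eq_sum]

lemma avg_zero (hP : IsHarnessMatrix P) : avg P 0 = 0 := by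
  ext i
  simp [hP.avg_eq_sum]

lemma avg_nonneg (hP : IsHarnessMatrix P) {z : Site d → ℝ} (h : ∀ i, 0 ≤ z i) (i : Site d) :
    0 ≤ avg P z i := by
  simpa [hP.avg_zero] using hP.avg_mono (z := 0) h i

/-- A lower bound for an average of a nonnegative surface by one of its terms. -/
lemma mul_le_avg (hP : IsHarnessMatrix P) {z : Site d → ℝ} (h : ∀ i, 0 ≤ z i) (i x : Site d) :
    P 0 x * z (i + x) ≤ avg P z i := by
  rw [hP.avg_eq_sum]
  by_cases hx : x ∈ hP.steps
  · exact Finset.single_le_sum (f := fun x => P 0 x * z (i + x))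
      (fun y _ => mul_nonneg (hP.nonneg _ _) (h _)) hx
  · have : P 0 x = 0 := by simpa [hP.mem_steps] using hx
    rw [this, zero_mul]
    exact Finset.sum_nonneg fun y _ => mul_nonneg (hP.nonneg _ _) (h _)

lemma avg_shift (hP : IsHarnessMatrix P) (z : Site d → ℝ) (b i : Site d) :
    avg P (fun j => z (j + b)) i = avg P z (i + b) := by
  simp only [hP.avg_eq_sum]
  exact Finset.sum_congr rfl fun x _ => by rw [add_right_comm]

/-- The weights of the `k`-th iterate of the averaging operator: its `k`-step transition
probabilities from the origin. -/
lemma exists_weights (hP : IsHarnessMatrix P) (k : ℕ) :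
    ∃ (T : Finset (Site d)) (q : Site d → ℝ), (∀ x, 0 ≤ q x) ∧ (∀ x, x ∉ T → q x = 0) ∧
      ∑ x ∈ T, q x = 1 ∧ ∀ z i, (avg P)^[k] z i = ∑ x ∈ T, q x * z (i + x) := by
  classical
  induction k with
  | zero =>
    refine ⟨{0}, Pi.single 0 1, fun x => ?_, fun x hx => ?_, by simp, by simp⟩
    · by_cases h : x = 0
      · simp [h]
      · simp [h]
    · simp only [Finset.mem_singleton] at hx
      simp [hx]
  | succ k ih =>
    obtain ⟨T, q, h0, hT, h1, hz⟩ := ih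
    -- Convolution: pairs (first step, remaining displacement) are grouped by their sum, the
    -- endpoint.
    have key : ∀ g : Site d → ℝ,
        ∑ x ∈ (hP.steps ×ˢ T).image (fun u => u.1 + u.2),
          (∑ u ∈ (hP.steps ×ˢ T) with u.1 + u.2 = x, P 0 u.1 * q u.2) * g x =
        ∑ y ∈ hP.steps, P 0 y * ∑ x ∈ T, q x * g (y + x) := by
      intro g
      have : ∀ x, (∑ u ∈ (hP.steps ×ˢ T) with u.1 + u.2 = x, P 0 u.1 * q u.2) * g x =
          ∑ u ∈ (hP.steps ×ˢ T) with u.1 + u.2 = x, P 0 u.1 * q u.2 * g (u.1 + u.2) := by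
        intro x
        rw [Finset.sum_mul]
        exact Finset.sum_congr rfl fun u hu => by rw [(Finset.mem_filter.1 hu).2]
      simp only [this]
      rw [Finset.sum_fiberwise_of_maps_to (fun u hu => Finset.mem_image_of_mem _ hu),
        Finset.sum_product]
      simp only [Finset.mul_sum, mul_assoc]
    refine ⟨(hP.steps ×ˢ T).image (fun u => u.1 + u.2),
      fun x => ∑ u ∈ (hP.steps ×ˢ T) with u.1 + u.2 = x, P 0 u.1 * q u.2,
      fun x => Finset.sum_nonneg fun u _ => mul_nonneg (hP.nonneg _ _) (h0 _), fun x hx => ?_,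
      ?_, fun z i => ?_⟩
    · refine Finset.sum_eq_zero fun u hu => ?_
      rw [Finset.mem_filter] at hu
      exact absurd (Finset.mem_image.2 ⟨u, hu.1, hu.2⟩) hx
    · have := key fun _ => 1
      simpa [h1, hP.sum_steps] using this
    · rw [Function.iterate_succ_apply', hP.avg_eq_sum, key fun x => z (i + x)]
      simp only [hz, add_assoc]

lemma avg_iterate_nonneg (hP : IsHarnessMatrix P) (k : ℕ) {z : Site d → ℝ}
    (h : ∀ i, 0 ≤ z i) (i : Site d) : 0 ≤ (avg P)^[k] z i := by
  obtain ⟨T, q, h0, -, -, hz⟩ := hP.exists_weights k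
  rw [hz]
  exact Finset.sum_nonneg fun x _ => mul_nonneg (h0 x) (h _)

/-- Generation of the lattice provides a nonzero step; were it the only step, the drift would be a
nonzero multiple of it, against centering. -/
lemma exists_ne_steps (hP : IsHarnessMatrix P) (hd : 1 ≤ d) :
    ∃ a b : Site d, a ≠ b ∧ P 0 a ≠ 0 ∧ P 0 b ≠ 0 := by
  have h1 : ∃ a : Site d, a ≠ 0 ∧ P 0 a ≠ 0 := by
    by_contra! h
    have hg := hP.generates
    have : AddSubgroup.closure {j : Site d | P 0 j ≠ 0} ≤ ⊥ := by
      rw [AddSubgroup.closure_le]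
      intro x hx
      by_contra hx0
      exact hx (h x (by simpa using hx0))
    rw [hg] at this
    have h2 : (fun _ => 1 : Site d) ∈ (⊥ : AddSubgroup (Site d)) := this trivial
    rw [AddSubgroup.mem_bot] at h2
    have := congrFun h2 ⟨0, hd⟩
    simp at this
  obtain ⟨a, ha0, ha⟩ := h1
  by_contra! h
  have hz : ∀ b, b ≠ a → P 0 b = 0 := fun b hb => h a b hb.symm ha
  obtain ⟨k, hk⟩ : ∃ k, a k ≠ 0 := by
    by_contra! h
    exact ha0 (funext h)
  have hc := hP.centered k
  rw [tsum_eq_single a (fun b hb => by rw [hz b hb, zero_mul])] at hc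
  rcases mul_eq_zero.1 hc with h | h
  · exact ha h
  · exact hk (by exact_mod_cast h)

/-- Testing the iterate on the indicator of a site identifies the weights of `exists_weights` with
`weight`. -/
lemma exists_avg_iterate_eq (hP : IsHarnessMatrix P) (k : ℕ) :
    ∃ T : Finset (Site d), (∀ x, 0 ≤ weight P k x) ∧ (∀ x, x ∉ T → weight P k x = 0) ∧
      ∑ x ∈ T, weight P k x = 1 ∧
      ∀ z i, (avg P)^[k] z i = ∑ x ∈ T, weight P k x * z (i + x) := by
  obtain ⟨T, q, h0, hT, h1, hz⟩ := hP.exists_weights k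
  have : weight P k = q := by
    ext x
    rw [weight, hz]
    simp only [zero_add, mul_ite, mul_one, mul_zero, Finset.sum_ite_eq']
    split_ifs with h
    · rfl
    · exact (hT x h).symm
  rw [this]
  exact ⟨T, h0, hT, h1, hz⟩

lemma weight_nonneg (hP : IsHarnessMatrix P) (k : ℕ) (x : Site d) : 0 ≤ weight P k x :=
  (hP.exists_avg_iterate_eq k).choose_spec.1 x

lemma weight_le_one (hP : IsHarnessMatrix P) (k : ℕ) (x : Site d) : weight P k x ≤ 1 := by
  obtain ⟨T, h0, hT, h1, -⟩ := hP.exists_avg_iterate_eq k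
  by_cases h : x ∈ T
  · rw [← h1]
    exact Finset.single_le_sum (fun y _ => h0 y) h
  · rw [hT x h]
    exact zero_le_one

lemma sum_weight_le_one (hP : IsHarnessMatrix P) (k : ℕ) (S : Finset (Site d)) :
    ∑ x ∈ S, weight P k x ≤ 1 := by
  classical
  obtain ⟨T, h0, hT, h1, -⟩ := hP.exists_avg_iterate_eq k
  rw [← h1]
  calc ∑ x ∈ S, weight P k x ≤ ∑ x ∈ S ∪ T, weight P k x :=
        Finset.sum_le_sum_of_subset_of_nonneg Finset.subset_union_left fun x _ _ => h0 x
    _ = ∑ x ∈ T, weight P k x :=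
        (Finset.sum_subset Finset.subset_union_right fun x _ hx => hT x hx).symm

/-- The Chapman-Kolmogorov equation. -/
lemma weight_add (hP : IsHarnessMatrix P) (r k : ℕ) :
    ∃ T : Finset (Site d), (∀ x, x ∉ T → weight P r x = 0) ∧ ∑ y ∈ T, weight P r y = 1 ∧
      ∀ x, weight P (r + k) x = ∑ y ∈ T, weight P r y * weight P k (x - y) := by
  obtain ⟨T, h0, hT, h1, hz⟩ := hP.exists_avg_iterate_eq r
  refine ⟨T, hT, h1, fun x => ?_⟩
  rw [weight, Function.iterate_add_apply, hz]
  refine Finset.sum_congr rfl fun y _ => ?_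
  obtain ⟨T', -, -, -, hz'⟩ := hP.exists_avg_iterate_eq k
  congr 1
  rw [hz', show weight P k (x - y) = (avg P)^[k] _ 0 from rfl, hz']
  refine Finset.sum_congr rfl fun u _ => ?_
  congr 2
  rw [zero_add, zero_add, eq_sub_iff_add_eq, add_comm]

lemma weight_pos_add (hP : IsHarnessMatrix P) {r k : ℕ} {x y : Site d} (hx : 0 < weight P r x)
    (hy : 0 < weight P k y) : 0 < weight P (r + k) (x + y) := by
  obtain ⟨T, hT, -, h⟩ := hP.weight_add r k
  rw [h]
  refine Finset.sum_pos' (fun u _ => mul_nonneg (hP.weight_nonneg _ _) (hP.weight_nonneg _ _))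
    ⟨x, ?_, ?_⟩
  · by_contra hx'
    exact hx.ne' (hT x hx')
  · rw [add_sub_cancel_left]
    exact mul_pos hx hy

lemma weight_nsmul_pos (hP : IsHarnessMatrix P) {a : Site d} (ha : P 0 a ≠ 0) (n : ℕ) :
    0 < weight P n (n • a) := by
  induction n with
  | zero => simp [weight_zero_zero]
  | succ n ih =>
    rw [succ_nsmul]
    refine hP.weight_pos_add ih ?_
    rw [weight_one]
    exact lt_of_le_of_ne (hP.nonneg _ _) (Ne.symm ha)

/-- For every `N` there are more than `N` sites reachable in the same number of steps. -/
lemma exists_card_weight_pos (hP : IsHarnessMatrix P) (hd : 1 ≤ d) (r : ℕ) :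
    ∃ S : Finset (Site d), S.card = r + 1 ∧ ∀ x ∈ S, 0 < weight P r x := by
  classical
  obtain ⟨a, b, hab, ha, hb⟩ := hP.exists_ne_steps hd
  -- With two distinct steps `a` and `b`, taking `i` steps `a` and `r - i` steps `b` leads to
  -- different sites for different `i`.
  refine ⟨(Finset.range (r + 1)).image (fun i => i • a + (r - i) • b), ?_, fun x hx => ?_⟩
  · rw [Finset.card_image_of_injOn, Finset.card_range]
    intro i hi j hj hij
    simp only [Finset.coe_range, Set.mem_Iio] at hi hj
    obtain ⟨k, hk⟩ : ∃ k, a k ≠ b k := by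
      by_contra! h
      exact hab (funext h)
    have := congrFun hij k
    simp only [Pi.add_apply, Pi.mul_apply, Pi.natCast_apply, nsmul_eq_mul] at this
    push_cast [show i ≤ r by omega, show j ≤ r by omega] at this
    have h2 : ((i : ℤ) - j) * (a k - b k) = 0 := by linarith
    rcases mul_eq_zero.1 h2 with h | h
    · omega
    · exact absurd (sub_eq_zero.1 h) hk
  · obtain ⟨i, hi, rfl⟩ := Finset.mem_image.1 hx
    have hi' : i + (r - i) = r := by
      have := Finset.mem_range.1 hi
      omega
    have := hP.weight_pos_add (hP.weight_nsmul_pos ha i) (hP.weight_nsmul_pos hb (r - i))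
    rwa [hi'] at this

/-- The transition probabilities of a truly `d`-dimensional matrix become uniformly small. -/
lemma exists_weight_le (hP : IsHarnessMatrix P) (hd : 1 ≤ d) {η : ℝ} (hη : 0 < η) :
    ∃ k : ℕ, ∀ x, weight P k x ≤ η := by
  classical
  let m : ℕ → ℝ := fun k => ⨆ x, weight P k x
  have hbdd : ∀ k, BddAbove (Set.range (weight P k)) := fun k =>
    ⟨1, by rintro _ ⟨x, rfl⟩; exact hP.weight_le_one k x⟩
  have hle : ∀ k x, weight P k x ≤ m k := fun k x => le_ciSup (hbdd k) x
  by_contra! hcon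
  have hηm : ∀ k, η ≤ m k := fun k => by
    obtain ⟨x, hx⟩ := hcon k
    exact hx.le.trans (hle k x)
  have hmbdd : BddBelow (Set.range m) := ⟨η, by rintro _ ⟨k, rfl⟩; exact hηm k⟩
  -- If the suprema `m k` stayed above `η`, a nearly maximal value at time `r + k`, being an average
  -- of values at time `k`, would force many values at time `k` to be nearly maximal too.
  set l := ⨅ k, m k
  have hηl : η ≤ l := le_ciInf hηm
  obtain ⟨r, hr⟩ := exists_nat_gt (2 / η)
  obtain ⟨S, hS, hSpos⟩ := hP.exists_card_weight_pos hd r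
  have hSne : S.Nonempty := Finset.card_pos.1 (by omega)
  obtain ⟨y₀, hy₀, hmin⟩ := S.exists_min_image (weight P r) hSne
  set w := weight P r y₀
  have hwpos : 0 < w := hSpos y₀ hy₀
  set δ := w * (η / 4) with hδ
  have hδpos : 0 < δ := by positivity
  obtain ⟨k, hk⟩ : ∃ k, m k < l + δ := exists_lt_of_ciInf_lt (by linarith)
  obtain ⟨x, hx⟩ : ∃ x, l - δ < weight P (r + k) x := by
    have : l - δ < m (r + k) := by
      have := ciInf_le hmbdd (r + k)
      linarith
    exact exists_lt_of_lt_ciSup this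
  obtain ⟨T, hT, hT1, hadd⟩ := hP.weight_add r k
  -- The gaps `l + δ - weight P k (x - u)` are nonnegative and average to less than `2 * δ`. A site
  -- of `S` carries weight at least `w`, so its gap is at most `2 * δ / w = η / 2`.
  have hlow : ∀ y ∈ S, η / 2 ≤ weight P k (x - y) := by
    intro y hy
    have hyT : y ∈ T := by
      by_contra h
      exact (hSpos y hy).ne' (hT y h)
    have h1 : weight P r y * (l + δ - weight P k (x - y)) ≤
        ∑ u ∈ T, weight P r u * (l + δ - weight P k (x - u)) :=
      Finset.single_le_sum (f := fun u => weight P r u * (l + δ - weight P k (x - u)))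
        (fun u _ => mul_nonneg (hP.weight_nonneg _ _) (by linarith [hle k (x - u)])) hyT
    have h2 : ∑ u ∈ T, weight P r u * (l + δ - weight P k (x - u)) =
        l + δ - weight P (r + k) x := by
      rw [hadd]
      simp only [mul_sub, Finset.sum_sub_distrib]
      rw [← Finset.sum_mul, hT1, one_mul]
    have h3 : w * (l + δ - weight P k (x - y)) ≤ w * (η / 2) := by
      calc w * (l + δ - weight P k (x - y))
          ≤ weight P r y * (l + δ - weight P k (x - y)) :=
            mul_le_mul_of_nonneg_right (hmin y hy) (by linarith [hle k (x - y)])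
        _ ≤ 2 * δ := by linarith
        _ = w * (η / 2) := by rw [hδ]; ring
    have h4 := le_of_mul_le_mul_left h3 hwpos
    linarith
  -- More than `2 / η` distinct sites of mass at least `η / 2` exceed the total mass one.
  have h5 := hP.sum_weight_le_one k (S.image fun y => x - y)
  rw [Finset.sum_image (fun y _ z _ h => sub_right_injective h)] at h5
  have h6 : (S.card : ℝ) * (η / 2) ≤ ∑ y ∈ S, weight P k (x - y) := by
    rw [← nsmul_eq_mul]
    exact Finset.card_nsmul_le_sum _ _ _ hlow
  rw [hS] at h6
  push_cast at h6
  rw [div_lt_iff₀ hη] at hr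
  nlinarith

end IsHarnessMatrix

end SerialHarness

/-! ### Wall and free surfaces: shifts, monotonicity, comparison. -/

namespace SerialHarness

variable {d : ℕ} {P : Site d → Site d → ℝ}

/-- The wall surface started flat at time `s`, after `n` steps driven by the noise `e`. -/
noncomputable def surf (P : Site d → Site d → ℝ) (e : ℤ → Site d → ℝ) (s : ℤ) :
    ℕ → Site d → ℝ
  | 0 => 0
  | n + 1 => wallStep P (surf P e s n) (e (s + n + 1))

/-- The surface without wall started flat at time `s`, after `n` steps driven by `e`. -/
noncomputable def free (P : Site d → Site d → ℝ) (e : ℤ → Site d → ℝ) (s : ℤ) :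
    ℕ → Site d → ℝ
  | 0 => 0
  | n + 1 => avg P (free P e s n) + e (s + n + 1)

lemma wallStep_eq (z e : Site d → ℝ) (i : Site d) :
    wallStep P z e i = max (avg P z i + e i) 0 := rfl

lemma wallStep_nonneg (z e : Site d → ℝ) (i : Site d) : 0 ≤ wallStep P z e i := le_max_right _ _

lemma surf_nonneg (e : ℤ → Site d → ℝ) (s : ℤ) (n : ℕ) (i : Site d) : 0 ≤ surf P e s n i := by
  cases n with
  | zero => exact le_rfl
  | succ n => exact wallStep_nonneg _ _ _

lemma wallProcess_eq_surf {Ω : Type*} (ε : ℤ → Site d → Ω → ℝ) (n : ℕ) (i : Site d) (ω : Ω) :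
    wallProcess P ε n i ω = surf P (fun m j => ε m j ω) 0 n i := by
  induction n generalizing i with
  | zero => rfl
  | succ n ih => simp only [wallProcess, surf, ih, zero_add]

lemma free_neg (hP : IsHarnessMatrix P) (e : ℤ → Site d → ℝ) (s : ℤ) (n : ℕ) :
    free P (fun m j => -e m j) s n = -free P e s n := by
  induction n with
  | zero => simp [free]
  | succ n ih =>
    rw [free, free, ih, hP.avg_neg, neg_add]
    rfl

lemma surf_shift (hP : IsHarnessMatrix P) (e : ℤ → Site d → ℝ) (a s : ℤ) (b : Site d) (n : ℕ)
    (i : Site d) :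
    surf P (fun m j => e (m + a) (j + b)) s n i = surf P e (s + a) n (i + b) := by
  induction n generalizing i with
  | zero => rfl
  | succ n ih =>
    rw [surf, surf, wallStep_eq, wallStep_eq, ← hP.avg_shift, funext ih,
      show s + a + (n : ℤ) + 1 = s + n + 1 + a by ring]

lemma free_shift (hP : IsHarnessMatrix P) (e : ℤ → Site d → ℝ) (a s : ℤ) (b : Site d) (n : ℕ)
    (i : Site d) :
    free P (fun m j => e (m + a) (j + b)) s n i = free P e (s + a) n (i + b) := by
  induction n generalizing i with
  | zero => rfl
  | succ n ih =>
    rw [free, free, Pi.add_apply, Pi.add_apply, ← hP.avg_shift, funext ih,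
      show s + a + (n : ℤ) + 1 = s + n + 1 + a by ring]

lemma wallStep_mono (hP : IsHarnessMatrix P) {z w : Site d → ℝ} (h : ∀ i, z i ≤ w i)
    (e : Site d → ℝ) (i : Site d) : wallStep P z e i ≤ wallStep P w e i :=
  max_le_max_right _ (add_le_add_left (hP.avg_mono h i) _)

/-- Starting earlier raises the surface. -/
lemma surf_le_surf_sub_one (hP : IsHarnessMatrix P) (e : ℤ → Site d → ℝ) (s : ℤ) (n : ℕ)
    (i : Site d) : surf P e s n i ≤ surf P e (s - 1) (n + 1) i := by
  induction n generalizing i with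
  -- At time `s` the older surface is already nonnegative, hence above the flat one; the dynamics
  -- preserves this order.
  | zero => exact surf_nonneg _ _ _ _
  | succ n ih =>
    rw [surf, surf.eq_def P e (s - 1)]
    simp only
    have : s - 1 + ((n + 1 : ℕ) : ℤ) + 1 = s + n + 1 := by push_cast; ring
    rw [this]
    exact wallStep_mono hP ih _ i

/-- From any time on, the wall surface dominates the surface that ignores the wall. -/
lemma avg_iterate_add_free_le_surf (hP : IsHarnessMatrix P) (e : ℤ → Site d → ℝ) (s : ℤ)
    (n k : ℕ) (i : Site d) :
    (avg P)^[k] (surf P e s n) i + free P e (s + n) k i ≤ surf P e s (n + k) i := by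
  induction k generalizing i with
  | zero => simp [free]
  | succ k ih =>
    rw [Function.iterate_succ_apply', ← add_assoc, surf, free, Pi.add_apply, ← add_assoc,
      wallStep_eq, ← Pi.add_apply (avg P _), ← hP.avg_add]
    refine le_max_of_le_left ?_
    have : s + ((n + k : ℕ) : ℤ) + 1 = s + n + k + 1 := by push_cast; ring
    rw [this]
    exact add_le_add_left (hP.avg_mono ih i) _

/-- The surface seen at time `t` when started flat at time `t - n`. -/
noncomputable def backSurf (P : Site d → Site d → ℝ) (e : ℤ → Site d → ℝ) (t : ℤ) (n : ℕ) :
    Site d → ℝ :=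
  surf P e (t - n) n

lemma backSurf_nonneg (e : ℤ → Site d → ℝ) (t : ℤ) (n : ℕ) (i : Site d) :
    0 ≤ backSurf P e t n i := surf_nonneg _ _ _ _

/-- Both sides start flat at the same time `t - n - 1`; only the last step is peeled off. -/
lemma backSurf_succ (e : ℤ → Site d → ℝ) (t : ℤ) (n : ℕ) :
    backSurf P e t (n + 1) = wallStep P (backSurf P e (t - 1) n) (e t) := by
  rw [backSurf, surf, backSurf]
  have h1 : t - ((n + 1 : ℕ) : ℤ) = t - 1 - n := by push_cast; ring
  rw [h1]
  congr 2
  ring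

lemma monotone_backSurf (hP : IsHarnessMatrix P) (e : ℤ → Site d → ℝ) (t : ℤ) (i : Site d) :
    Monotone fun n => backSurf P e t n i := by
  refine monotone_nat_of_le_succ fun n => ?_
  have := surf_le_surf_sub_one hP e (t - n) n i
  rwa [show t - (n : ℤ) - 1 = t - ((n + 1 : ℕ) : ℤ) by push_cast; ring] at this

/-! ### Measurability, dependence cones and integrability. -/

section Measurability

variable {Ω : Type*} {mΩ : MeasurableSpace Ω}

lemma IsHarnessMatrix.measurable_avg (hP : IsHarnessMatrix P) {Z : Ω → Site d → ℝ} {i : Site d}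
    (h : ∀ x, P 0 x ≠ 0 → Measurable fun ω => Z ω (i + x)) :
    Measurable fun ω => avg P (Z ω) i := by
  simp only [hP.avg_eq_sum]
  exact Finset.measurable_sum _ fun x hx => (h x (hP.mem_steps.1 hx)).const_mul _

/-- The backward cone of dependence widens by at most `R` per step. The σ-algebra on `Ω` is
arbitrary, so that it can be the one generated by the noise in the cone. -/
lemma measurable_surf_of_range (hP : IsHarnessMatrix P) {R : ℕ}
    (hR : ∀ x : Site d, P 0 x ≠ 0 → ‖x‖ ≤ R) {X : Ω → ℤ → Site d → ℝ} {s : ℤ} {n : ℕ} {i : Site d}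
    (h : ∀ m j, s < m → m ≤ s + n → ‖j - i‖ ≤ R * n → Measurable fun ω => X ω m j) :
    Measurable fun ω => surf P (X ω) s n i := by
  induction n generalizing i with
  | zero => exact measurable_const
  | succ n ih =>
    simp only [surf, wallStep_eq]
    refine ((hP.measurable_avg fun x hx => ih fun m j h1 h2 h3 => h m j h1 ?_ ?_).add
      (h _ _ ?_ ?_ ?_)).max measurable_const
    · push_cast
      omega
    · push_cast
      calc ‖j - i‖ = ‖(j - (i + x)) + x‖ := by congr 1; abel
        _ ≤ ‖j - (i + x)‖ + ‖x‖ := norm_add_le _ _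
        _ ≤ R * (n + 1) := by linarith [hR x hx]
    · omega
    · push_cast
      omega
    · simp only [sub_self, norm_zero]
      positivity

lemma measurable_surf (hP : IsHarnessMatrix P) {X : Ω → ℤ → Site d → ℝ} {s : ℤ} {n : ℕ}
    {i : Site d} (h : ∀ m j, s < m → m ≤ s + n → Measurable fun ω => X ω m j) :
    Measurable fun ω => surf P (X ω) s n i := by
  obtain ⟨R, hR⟩ := hP.exists_range
  exact measurable_surf_of_range hP hR fun m j h1 h2 _ => h m j h1 h2

lemma measurable_backSurf (hP : IsHarnessMatrix P) {X : Ω → ℤ → Site d → ℝ} {t : ℤ} {n : ℕ}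
    {i : Site d} (h : ∀ m j, m ≤ t → Measurable fun ω => X ω m j) :
    Measurable fun ω => backSurf P (X ω) t n i :=
  measurable_surf hP fun m j _ h2 => h m j (by omega)

lemma measurable_avg_iterate (hP : IsHarnessMatrix P) {Z : Ω → Site d → ℝ} (k : ℕ)
    (h : ∀ x, Measurable fun ω => Z ω x) (i : Site d) :
    Measurable fun ω => (avg P)^[k] (Z ω) i := by
  obtain ⟨T, -, -, -, hz⟩ := hP.exists_avg_iterate_eq k
  simp only [hz]
  exact Finset.measurable_sum _ fun x _ => (h _).const_mul _

lemma measurable_free (hP : IsHarnessMatrix P) {X : Ω → ℤ → Site d → ℝ} {s : ℤ} {n : ℕ}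
    {i : Site d} (h : ∀ m j, s < m → Measurable fun ω => X ω m j) :
    Measurable fun ω => free P (X ω) s n i := by
  induction n generalizing i with
  | zero => exact measurable_const
  | succ n ih =>
    simp only [free]
    exact (hP.measurable_avg fun x _ => ih).add (h _ _ (by omega))

/-- A uniformly negative noise drives the free surface down linearly. -/
lemma free_le_of_range (hP : IsHarnessMatrix P) {R : ℕ}
    (hR : ∀ x : Site d, P 0 x ≠ 0 → ‖x‖ ≤ R) {e : ℤ → Site d → ℝ} {δ : ℝ} {s : ℤ} {n : ℕ}
    {i : Site d} (h : ∀ m j, s < m → m ≤ s + n → ‖j - i‖ ≤ R * n → e m j ≤ -δ) :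
    free P e s n i ≤ -(n * δ) := by
  induction n generalizing i with
  | zero => simp [free]
  | succ n ih =>
    have h1 : ∀ x, P 0 x ≠ 0 → free P e s n (i + x) ≤ -(n * δ) := by
      refine fun x hx => ih fun m j h1 h2 h3 => h m j h1 ?_ ?_
      · push_cast
        omega
      · push_cast
        calc ‖j - i‖ = ‖(j - (i + x)) + x‖ := by congr 1; abel
          _ ≤ ‖j - (i + x)‖ + ‖x‖ := norm_add_le _ _
          _ ≤ R * (n + 1) := by linarith [hR x hx]
    have h2 : e (s + n + 1) i ≤ -δ := by
      refine h _ _ (by omega) (by push_cast; omega) ?_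
      simp only [sub_self, norm_zero]
      positivity
    have h3 : avg P (free P e s n) i ≤ -(n * δ) := by
      rw [hP.avg_eq_sum]
      calc ∑ x ∈ hP.steps, P 0 x * free P e s n (i + x)
          ≤ ∑ x ∈ hP.steps, P 0 x * -(n * δ) :=
            Finset.sum_le_sum fun x hx =>
              mul_le_mul_of_nonneg_left (h1 x (hP.mem_steps.1 hx)) (hP.nonneg _ _)
        _ = -(n * δ) := by rw [← Finset.sum_mul, hP.sum_steps, one_mul]
    rw [free, Pi.add_apply]
    push_cast
    linarith

lemma integrable_avg (hP : IsHarnessMatrix P) {μ : Measure Ω} {Z : Ω → Site d → ℝ}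
    (h : ∀ x, Integrable (fun ω => Z ω x) μ) (i : Site d) :
    Integrable (fun ω => avg P (Z ω) i) μ := by
  simp only [hP.avg_eq_sum]
  exact integrable_finsetSum _ fun x _ => (h _).const_mul _

lemma integrable_surf (hP : IsHarnessMatrix P) {μ : Measure Ω} {X : Ω → ℤ → Site d → ℝ}
    (h : ∀ m j, Integrable (fun ω => X ω m j) μ) (s : ℤ) (n : ℕ) (i : Site d) :
    Integrable (fun ω => surf P (X ω) s n i) μ := by
  induction n generalizing i with
  | zero => exact integrable_zero _ _ _
  | succ n ih =>
    simp only [surf, wallStep_eq]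
    exact ((integrable_avg hP ih i).add (h _ _)).pos_part

lemma integrable_free (hP : IsHarnessMatrix P) {μ : Measure Ω} {X : Ω → ℤ → Site d → ℝ}
    (h : ∀ m j, Integrable (fun ω => X ω m j) μ) (s : ℤ) (n : ℕ) (i : Site d) :
    Integrable (fun ω => free P (X ω) s n i) μ := by
  induction n generalizing i with
  | zero => exact integrable_zero _ _ _
  | succ n ih =>
    simp only [free]
    exact (integrable_avg hP ih i).add (h _ _)

end Measurability

end SerialHarness

/-! ### Independence, stationarity and symmetry of the noise. -/

namespace SerialHarness

variable {d : ℕ} {P : Site d → Site d → ℝ}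

/-- Two families of independent random variables with the same marginals have the same law. -/
lemma identDistrib_of_iIndepFun {ι Ω E : Type*} [MeasurableSpace Ω] [MeasurableSpace E]
    {μ : Measure Ω} {X Y : ι → Ω → E} (hX : iIndepFun X μ) (hY : iIndepFun Y μ)
    (mX : ∀ i, Measurable (X i)) (mY : ∀ i, Measurable (Y i))
    (h : ∀ i, IdentDistrib (X i) (Y i) μ μ) :
    IdentDistrib (fun ω i => X i ω) (fun ω i => Y i ω) μ μ where
  aemeasurable_fst := (measurable_pi_iff.2 mX).aemeasurable
  aemeasurable_snd := (measurable_pi_iff.2 mY).aemeasurable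
  map_eq := by
    rw [hX.map_fun_eq_infinitePi_map mX, hY.map_fun_eq_infinitePi_map mY]
    congr 1
    exact funext fun i => (h i).map_eq

variable {Ω : Type*}

/-- The information carried by the noise variables with index in `S`. -/
@[reducible] def noiseAlg (ε : ℤ → Site d → Ω → ℝ) (S : Set (ℤ × Site d)) : MeasurableSpace Ω :=
  ⨆ k ∈ S, MeasurableSpace.comap (ε k.1 k.2) inferInstance

lemma measurable_noiseAlg (ε : ℤ → Site d → Ω → ℝ) {S : Set (ℤ × Site d)} {m : ℤ} {j : Site d}
    (h : (m, j) ∈ S) : Measurable[noiseAlg ε S] (ε m j) := by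
  rw [measurable_iff_comap_le]
  exact le_iSup₂_of_le (f := fun (k : ℤ × Site d) (_ : k ∈ S) =>
    MeasurableSpace.comap (ε k.1 k.2) inferInstance) (m, j) h le_rfl

namespace IsSymmetricNoise

variable [mΩ : MeasurableSpace Ω] {μ : Measure Ω} {ε : ℤ → Site d → Ω → ℝ}

/-- Serves to separate past from future, and disjoint dependence cones from each other. -/
lemma indepFun (hε : IsSymmetricNoise μ ε) {S T : Set (ℤ × Site d)} (hST : Disjoint S T)
    {E F : Type*} [MeasurableSpace E] [MeasurableSpace F] {X : Ω → E} {Y : Ω → F}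
    (hX : Measurable[noiseAlg ε S] X) (hY : Measurable[noiseAlg ε T] Y) : IndepFun X Y μ := by
  rw [IndepFun_iff_Indep]
  have h := indep_iSup_of_disjoint (m := fun k : ℤ × Site d =>
    MeasurableSpace.comap (ε k.1 k.2) inferInstance)
    (fun k => (hε.measurable k.1 k.2).comap_le) hε.indep.iIndep hST
  exact indep_of_indep_of_le_left (indep_of_indep_of_le_right h hY.comap_le) hX.comap_le

lemma measurable_noise (hε : IsSymmetricNoise μ ε) : Measurable fun ω m j => ε m j ω :=
  measurable_pi_lambda _ fun m => measurable_pi_lambda _ fun j => hε.measurable m j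

lemma measurable_curry_pi :
    Measurable fun (x : ℤ × Site d → ℝ) (m : ℤ) (j : Site d) => x (m, j) :=
  measurable_pi_lambda _ fun _ => measurable_pi_lambda _ fun _ => measurable_pi_apply _

lemma integrable_noise (hε : IsSymmetricNoise μ ε) (m : ℤ) (j : Site d) :
    Integrable (fun ω => ε m j ω) μ :=
  (hε.identDistrib m j).integrable_iff.2 hε.integrable

lemma identDistrib_shift (hε : IsSymmetricNoise μ ε) (a : ℤ) (b : Site d) :
    IdentDistrib (fun ω m j => ε (m + a) (j + b) ω) (fun ω m j => ε m j ω) μ μ := by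
  have hinj : Function.Injective fun k : ℤ × Site d => (k.1 + a, k.2 + b) := by
    rintro ⟨m, j⟩ ⟨m', j'⟩ h
    simpa using h
  exact (identDistrib_of_iIndepFun (iIndepFun.precomp (g := fun k : ℤ × Site d => (k.1 + a, k.2 + b)) hinj hε.indep) hε.indep
    (fun k => hε.measurable _ _) (fun k => hε.measurable _ _)
    (fun k => (hε.identDistrib _ _).trans (hε.identDistrib _ _).symm)).comp measurable_curry_pi

lemma identDistrib_neg (hε : IsSymmetricNoise μ ε) :
    IdentDistrib (fun ω m j => -ε m j ω) (fun ω m j => ε m j ω) μ μ := by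
  have h1 : iIndepFun (fun (k : ℤ × Site d) ω => -ε k.1 k.2 ω) μ :=
    hε.indep.comp (fun _ x => -x) fun _ => measurable_neg
  exact (identDistrib_of_iIndepFun h1 hε.indep
    (fun k => (hε.measurable _ _).neg) (fun k => hε.measurable _ _)
    (fun k => ((hε.identDistrib _ _).comp measurable_neg).trans
      (hε.symmetric.trans (hε.identDistrib _ _).symm))).comp measurable_curry_pi

lemma measurable_surf_eval (hP : IsHarnessMatrix P) (s : ℤ) (n : ℕ) (i : Site d) :
    Measurable fun e : ℤ → Site d → ℝ => surf P e s n i :=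
  measurable_surf hP fun m j _ _ => (measurable_pi_apply j).comp (measurable_pi_apply m)

lemma measurable_free_eval (hP : IsHarnessMatrix P) (s : ℤ) (n : ℕ) (i : Site d) :
    Measurable fun e : ℤ → Site d → ℝ => free P e s n i :=
  measurable_free hP fun m j _ => (measurable_pi_apply j).comp (measurable_pi_apply m)

lemma identDistrib_surf (hP : IsHarnessMatrix P) (hε : IsSymmetricNoise μ ε) (s : ℤ) (n : ℕ)
    (i : Site d) :
    IdentDistrib (fun ω => surf P (fun m j => ε m j ω) s n i)
      (fun ω => surf P (fun m j => ε m j ω) 0 n 0) μ μ := by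
  have := (hε.identDistrib_shift s i).comp (measurable_surf_eval hP 0 n 0)
  have e : ∀ ω, surf P (fun m j => ε (m + s) (j + i) ω) 0 n 0 = surf P (fun m j => ε m j ω) s n i :=
    fun ω => by simpa using surf_shift hP (fun m j => ε m j ω) s 0 i n 0
  simpa only [Function.comp_def, e] using this

lemma identDistrib_free (hP : IsHarnessMatrix P) (hε : IsSymmetricNoise μ ε) (s : ℤ) (n : ℕ)
    (i : Site d) :
    IdentDistrib (fun ω => free P (fun m j => ε m j ω) s n i)
      (fun ω => free P (fun m j => ε m j ω) 0 n 0) μ μ := by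
  have := (hε.identDistrib_shift s i).comp (measurable_free_eval hP 0 n 0)
  have e : ∀ ω, free P (fun m j => ε (m + s) (j + i) ω) 0 n 0 = free P (fun m j => ε m j ω) s n i :=
    fun ω => by simpa using free_shift hP (fun m j => ε m j ω) s 0 i n 0
  simpa only [Function.comp_def, e] using this

lemma identDistrib_neg_free (hP : IsHarnessMatrix P) (hε : IsSymmetricNoise μ ε) (s : ℤ) (n : ℕ)
    (i : Site d) :
    IdentDistrib (fun ω => -free P (fun m j => ε m j ω) s n i)
      (fun ω => free P (fun m j => ε m j ω) s n i) μ μ := by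
  have := hε.identDistrib_neg.comp (measurable_free_eval hP s n i)
  simpa only [Function.comp_def, free_neg hP (fun m j => ε m j _), Pi.neg_apply] using this

lemma integral_free (hP : IsHarnessMatrix P) (hε : IsSymmetricNoise μ ε) (s : ℤ) (n : ℕ)
    (i : Site d) : ∫ ω, free P (fun m j => ε m j ω) s n i ∂μ = 0 := by
  have := (hε.identDistrib_neg_free hP s n i).integral_eq
  rw [integral_neg] at this
  linarith

/-- The events that the height is nonnegative and that its opposite is have equal probability and
cover everything. -/
lemma half_le_measureReal_free_nonneg [IsProbabilityMeasure μ] (hP : IsHarnessMatrix P) (hε : IsSymmetricNoise μ ε) (s : ℤ)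
    (n : ℕ) (i : Site d) :
    1 / 2 ≤ μ.real {ω | 0 ≤ free P (fun m j => ε m j ω) s n i} := by
  have h := (hε.identDistrib_neg_free hP s n i).measure_mem_eq measurableSet_Ici (s := Set.Ici 0)
  have h' : μ.real {ω | 0 ≤ -free P (fun m j => ε m j ω) s n i} =
      μ.real {ω | 0 ≤ free P (fun m j => ε m j ω) s n i} := congrArg ENNReal.toReal h
  have h1 := measureReal_union_le (μ := μ) {ω | 0 ≤ free P (fun m j => ε m j ω) s n i}
    {ω | 0 ≤ -free P (fun m j => ε m j ω) s n i}
  have h2 : {ω | 0 ≤ free P (fun m j => ε m j ω) s n i} ∪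
    {ω | 0 ≤ -free P (fun m j => ε m j ω) s n i} = Set.univ := by
    ext ω
    simp only [Set.mem_union, Set.mem_ofPred_eq, Set.mem_univ, iff_true, Left.nonneg_neg_iff]
    exact le_total _ _
  rw [h2, probReal_univ, h'] at h1
  linarith

/-- Otherwise the noise is almost surely nonnegative, hence by symmetry nonpositive, hence zero. -/
lemma exists_measure_le_neg_pos (hε : IsSymmetricNoise μ ε) (hε0 : ¬ ∀ᵐ ω ∂μ, ε 0 0 ω = 0) :
    ∃ δ : ℝ, 0 < δ ∧ 0 < μ {ω | ε 0 0 ω ≤ -δ} := by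
  by_contra! h
  have h1 : ∀ᵐ ω ∂μ, 0 ≤ ε 0 0 ω := by
    have : ∀ n : ℕ, ∀ᵐ ω ∂μ, -(1 / ((n : ℝ) + 1)) < ε 0 0 ω := by
      intro n
      have := h (1 / ((n : ℝ) + 1)) Nat.one_div_pos_of_nat
      rw [ae_iff]
      simpa using this
    filter_upwards [ae_all_iff.2 this] with ω hω
    by_contra! hneg
    obtain ⟨n, hn⟩ := exists_nat_one_div_lt (neg_pos.2 hneg)
    linarith [hω n]
  have h2 : ∀ᵐ ω ∂μ, 0 ≤ -ε 0 0 ω :=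
    hε.symmetric.symm.ae_snd (p := fun x => 0 ≤ x) measurableSet_Ici h1
  exact hε0 (by filter_upwards [h1, h2] with ω a b; linarith)

/-- The free surface goes arbitrarily far down with positive probability. -/
lemma exists_measure_free_lt_pos (hP : IsHarnessMatrix P) (hε : IsSymmetricNoise μ ε)
    (hε0 : ¬ ∀ᵐ ω ∂μ, ε 0 0 ω = 0) (A : ℝ) :
    ∃ k : ℕ, 0 < μ {ω | free P (fun m j => ε m j ω) 0 k 0 < -A} := by
  obtain ⟨δ, hδ, hpos⟩ := hε.exists_measure_le_neg_pos hε0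
  obtain ⟨R, hR⟩ := hP.exists_range
  obtain ⟨k, hk⟩ := exists_nat_gt (A / δ)
  rw [div_lt_iff₀ hδ] at hk
  have hfin : (Metric.closedBall (0 : Site d) (R * k)).Finite :=
    (isCompact_closedBall _ _).finite_of_discrete
  -- This finite box contains the dependence cone. By independence all its noises are at most `-δ`
  -- with positive probability, and then the height is at most `-(k * δ) < -A`.
  let F : Finset (ℤ × Site d) := Finset.Ioc 0 (k : ℤ) ×ˢ hfin.toFinset
  have h1 := hε.indep.measure_inter_preimage_eq_mul F (sets := fun _ => Set.Iic (-δ))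
    fun _ _ => measurableSet_Iic
  have h2 : 0 < μ (⋂ p ∈ F, (fun ω => ε p.1 p.2 ω) ⁻¹' Set.Iic (-δ)) := by
    rw [h1]
    refine pos_iff_ne_zero.2 (Finset.prod_ne_zero_iff.2 fun p _ => ?_)
    rw [show μ ((fun ω => ε p.1 p.2 ω) ⁻¹' Set.Iic (-δ)) = μ (ε 0 0 ⁻¹' Set.Iic (-δ)) from
      (hε.identDistrib p.1 p.2).measure_mem_eq measurableSet_Iic]
    exact hpos.ne'
  refine ⟨k, h2.trans_le (measure_mono fun ω hω => ?_)⟩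
  simp only [Set.mem_iInter, Set.mem_preimage, Set.mem_Iic, F, Finset.mem_product,
    Finset.mem_Ioc, Set.Finite.mem_toFinset, Metric.mem_closedBall, dist_zero_right] at hω
  have := free_le_of_range hP hR (e := fun m j => ε m j ω) (s := 0) (n := k) (i := 0)
    (δ := δ) fun m j a b c => hω (m, j) ⟨⟨a, by simpa using b⟩, by simpa using c⟩
  simp only [Set.mem_ofPred_eq]
  linarith

end IsSymmetricNoise

end SerialHarness

/-! ### Concentration of averages, growth of the mean, escape with probability 1/3. -/

namespace SerialHarness

variable {d : ℕ} {P : Site d → Site d → ℝ}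

/-- A law of large numbers estimate: averages of a bounded field with finite range dependence
concentrate when the weights are uniformly small. -/
lemma integral_sq_weighted_sum_le {Ω : Type*} [MeasurableSpace Ω] {μ : Measure Ω}
    [IsProbabilityMeasure μ] {Y : Site d → Ω → ℝ} {L c D η : ℝ} (hY : ∀ x, Measurable (Y x))
    (h0 : ∀ x ω, 0 ≤ Y x ω) (hL : ∀ x ω, Y x ω ≤ L) (hc : ∀ x, ∫ ω, Y x ω ∂μ = c)
    (hind : ∀ x y, D < ‖x - y‖ → IndepFun (Y x) (Y y) μ) {B : Finset (Site d)}
    (hB : ∀ x, ‖x‖ ≤ D → x ∈ B) {T : Finset (Site d)} {q : Site d → ℝ} (hq : ∀ x, 0 ≤ q x)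
    (hq1 : ∑ x ∈ T, q x = 1) (hqη : ∀ x, q x ≤ η) :
    ∫ ω, (∑ x ∈ T, q x * Y x ω - c) ^ 2 ∂μ ≤ B.card * η * L ^ 2 := by
  classical
  have hη : 0 ≤ η := (hq 0).trans (hqη 0)
  have hint : ∀ x, Integrable (Y x) μ := fun x =>
    Integrable.of_bound (hY x).aestronglyMeasurable L
      (ae_of_all _ fun ω => by rw [Real.norm_of_nonneg (h0 x ω)]; exact hL x ω)
  have hc0 : 0 ≤ c := by rw [← hc 0]; exact integral_nonneg (h0 0)
  have hcL : c ≤ L := by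
    rw [← hc 0]
    simpa using integral_mono (hint 0) (integrable_const L) (hL 0)
  have hV : ∀ x ω, |Y x ω - c| ≤ L := fun x ω => by
    rw [abs_le]
    constructor <;> linarith [h0 x ω, hL x ω]
  have hVm : ∀ x, Measurable fun ω => Y x ω - c := fun x => (hY x).sub_const c
  have hVV : ∀ x y ω, (Y x ω - c) * (Y y ω - c) ≤ L ^ 2 := fun x y ω => by
    rw [sq]
    exact (le_abs_self _).trans (by
      rw [abs_mul]
      exact mul_le_mul (hV x ω) (hV y ω) (abs_nonneg _) (hc0.trans hcL))
  have hVint : ∀ x y, Integrable (fun ω => (Y x ω - c) * (Y y ω - c)) μ := fun x y =>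
    Integrable.of_bound ((hVm x).mul (hVm y)).aestronglyMeasurable (L * L)
      (ae_of_all _ fun ω => by
        rw [Real.norm_eq_abs, abs_mul]
        exact mul_le_mul (hV x ω) (hV y ω) (abs_nonneg _) (hc0.trans hcL))
  -- Only pairs with `x - y ∈ B` may be correlated; all other covariances vanish by independence.
  have hcov : ∀ x y, ∫ ω, (Y x ω - c) * (Y y ω - c) ∂μ ≤ if x - y ∈ B then L ^ 2 else 0 := by
    intro x y
    split_ifs with h
    · simpa using integral_mono (hVint x y) (integrable_const (L ^ 2)) (hVV x y)
    · have hi : IndepFun (fun ω => Y x ω - c) (fun ω => Y y ω - c) μ :=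
        (hind x y (by by_contra! h'; exact h (hB _ h'))).comp
          (measurable_id.sub_const c) (measurable_id.sub_const c)
      rw [hi.integral_fun_mul_eq_mul_integral (hVm x).aestronglyMeasurable
        (hVm y).aestronglyMeasurable, integral_sub (hint x) (integrable_const c), hc]
      simp
  have hexp : ∀ ω, (∑ x ∈ T, q x * Y x ω - c) ^ 2 =
      ∑ x ∈ T, ∑ y ∈ T, q x * q y * ((Y x ω - c) * (Y y ω - c)) := by
    intro ω
    have : ∑ x ∈ T, q x * Y x ω - c = ∑ x ∈ T, q x * (Y x ω - c) := by
      simp only [mul_sub, Finset.sum_sub_distrib, ← Finset.sum_mul, hq1, one_mul]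
    rw [this, sq, Finset.sum_mul_sum]
    exact Finset.sum_congr rfl fun x _ => Finset.sum_congr rfl fun y _ => by ring
  simp only [hexp]
  rw [integral_finsetSum _ fun x _ => integrable_finsetSum _ fun y _ => (hVint x y).const_mul _]
  -- For fixed `x` at most `B.card` sites `y` contribute, each of weight at most `η`.
  have hrow : ∀ x, ∑ y ∈ T, q y * (if x - y ∈ B then L ^ 2 else 0) ≤ B.card * η * L ^ 2 := by
    intro x
    have : ∀ y, q y * (if x - y ∈ B then L ^ 2 else 0) = if x - y ∈ B then q y * L ^ 2 else 0 :=
      fun y => by split_ifs <;> simp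
    simp only [this]
    rw [← Finset.sum_filter]
    calc ∑ y ∈ T with x - y ∈ B, q y * L ^ 2
        ≤ (T.filter fun y => x - y ∈ B).card • (η * L ^ 2) :=
          Finset.sum_le_card_nsmul _ _ _ fun y _ =>
            mul_le_mul_of_nonneg_right (hqη y) (sq_nonneg L)
      _ ≤ B.card • (η * L ^ 2) := by
          refine nsmul_le_nsmul_left (by positivity) ?_
          refine Finset.card_le_card_of_injOn (fun y => x - y)
            (fun y hy => (Finset.mem_filter.1 hy).2) fun y _ z _ h => sub_right_injective h
      _ = B.card * η * L ^ 2 := by rw [nsmul_eq_mul, mul_assoc]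
  calc ∑ x ∈ T, ∫ ω, ∑ y ∈ T, q x * q y * ((Y x ω - c) * (Y y ω - c)) ∂μ
      = ∑ x ∈ T, ∑ y ∈ T, q x * q y * ∫ ω, (Y x ω - c) * (Y y ω - c) ∂μ := by
        refine Finset.sum_congr rfl fun x _ => ?_
        rw [integral_finsetSum _ fun y _ => (hVint x y).const_mul _]
        exact Finset.sum_congr rfl fun y _ => integral_const_mul _ _
    _ ≤ ∑ x ∈ T, q x * ∑ y ∈ T, q y * (if x - y ∈ B then L ^ 2 else 0) := by
        refine Finset.sum_le_sum fun x _ => ?_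
        rw [Finset.mul_sum]
        refine Finset.sum_le_sum fun y _ => ?_
        rw [mul_assoc]
        exact mul_le_mul_of_nonneg_left (mul_le_mul_of_nonneg_left (hcov x y) (hq y)) (hq x)
    _ ≤ ∑ x ∈ T, q x * (B.card * η * L ^ 2) :=
        Finset.sum_le_sum fun x _ => mul_le_mul_of_nonneg_left (hrow x) (hq x)
    _ = B.card * η * L ^ 2 := by rw [← Finset.sum_mul, hq1, one_mul]

/-- The noise configuration at `ω`. -/
abbrev field {Ω : Type*} (ε : ℤ → Site d → Ω → ℝ) (ω : Ω) : ℤ → Site d → ℝ := fun m j => ε m j ω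

namespace IsSymmetricNoise

variable {Ω : Type*} [MeasurableSpace Ω] {μ : Measure Ω} {ε : ℤ → Site d → Ω → ℝ}

lemma measurable_surf (hP : IsHarnessMatrix P) (hε : IsSymmetricNoise μ ε) (s : ℤ) (n : ℕ)
    (i : Site d) : Measurable fun ω => surf P (field ε ω) s n i :=
  (measurable_surf_eval hP s n i).comp hε.measurable_noise

lemma measurable_free (hP : IsHarnessMatrix P) (hε : IsSymmetricNoise μ ε) (s : ℤ) (n : ℕ)
    (i : Site d) : Measurable fun ω => free P (field ε ω) s n i :=
  (measurable_free_eval hP s n i).comp hε.measurable_noise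

lemma integrable_surf (hP : IsHarnessMatrix P) (hε : IsSymmetricNoise μ ε) (s : ℤ) (n : ℕ)
    (i : Site d) : Integrable (fun ω => surf P (field ε ω) s n i) μ :=
  SerialHarness.integrable_surf hP (X := field ε) hε.integrable_noise s n i

lemma integral_avg_iterate_surf (hP : IsHarnessMatrix P) (hε : IsSymmetricNoise μ ε) (n k : ℕ) :
    ∫ ω, (avg P)^[k] (surf P (field ε ω) 0 n) 0 ∂μ = ∫ ω, surf P (field ε ω) 0 n 0 ∂μ := by
  obtain ⟨T, -, -, h1, hz⟩ := hP.exists_avg_iterate_eq k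
  simp only [hz]
  rw [integral_finsetSum _ fun x _ => (hε.integrable_surf hP 0 n _).const_mul _]
  simp only [integral_const_mul, (hε.identDistrib_surf hP 0 n _).integral_eq]
  rw [← Finset.sum_mul, h1, one_mul]

lemma integrable_avg_iterate_surf (hP : IsHarnessMatrix P) (hε : IsSymmetricNoise μ ε)
    (n k : ℕ) : Integrable (fun ω => (avg P)^[k] (surf P (field ε ω) 0 n) 0) μ := by
  obtain ⟨T, -, -, h1, hz⟩ := hP.exists_avg_iterate_eq k
  simp only [hz]
  exact integrable_finsetSum _ fun x _ => (hε.integrable_surf hP 0 n _).const_mul _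

lemma indepFun_avg_iterate_free (hP : IsHarnessMatrix P) (hε : IsSymmetricNoise μ ε) (n k : ℕ) :
    IndepFun (fun ω => (avg P)^[k] (surf P (field ε ω) 0 n) 0)
      (fun ω => free P (field ε ω) n k 0) μ := by
  refine hε.indepFun (S := {p | p.1 ≤ n}) (T := {p | (n : ℤ) < p.1}) ?_ ?_ ?_
  · rw [Set.disjoint_left]
    intro p h1 h2
    simp only [Set.mem_ofPred_eq] at h1 h2
    omega
  · refine measurable_avg_iterate (mΩ := noiseAlg ε _) hP k (fun x => ?_) 0
    refine SerialHarness.measurable_surf (mΩ := noiseAlg ε _) hP fun m j _ h => ?_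
    exact measurable_noiseAlg ε (by simpa using h)
  · refine SerialHarness.measurable_free (mΩ := noiseAlg ε _) hP fun m j h => ?_
    exact measurable_noiseAlg ε (by simpa using h)

/-- Heights at sites far apart are independent. -/
lemma indepFun_surf (hP : IsHarnessMatrix P) (hε : IsSymmetricNoise μ ε) {R : ℕ}
    (hR : ∀ x : Site d, P 0 x ≠ 0 → ‖x‖ ≤ R) {n : ℕ} {x y : Site d}
    (hxy : (2 * R * n : ℝ) < ‖x - y‖) :
    IndepFun (fun ω => surf P (field ε ω) 0 n x) (fun ω => surf P (field ε ω) 0 n y) μ := by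
  refine hε.indepFun (S := {p | ‖p.2 - x‖ ≤ R * n}) (T := {p | ‖p.2 - y‖ ≤ R * n}) ?_ ?_ ?_
  · rw [Set.disjoint_left]
    intro p h1 h2
    simp only [Set.mem_ofPred_eq] at h1 h2
    have h3 := norm_sub_le_norm_sub_add_norm_sub x p.2 y
    rw [norm_sub_rev x p.2] at h3
    linarith
  · exact measurable_surf_of_range (mΩ := noiseAlg ε _) hP hR fun m j _ _ h =>
      measurable_noiseAlg ε (by simpa using h)
  · exact measurable_surf_of_range (mΩ := noiseAlg ε _) hP hR fun m j _ _ h =>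
      measurable_noiseAlg ε (by simpa using h)

variable [IsProbabilityMeasure μ]

/-- The wall pushes the mean up whenever the free surface would go below it. -/
lemma integral_surf_add_le (hP : IsHarnessMatrix P) (hε : IsSymmetricNoise μ ε) (n k : ℕ)
    (A : ℝ) :
    ∫ ω, surf P (field ε ω) 0 n 0 ∂μ +
      μ.real {ω | (avg P)^[k] (surf P (field ε ω) 0 n) 0 ≤ A} *
        μ.real {ω | free P (field ε ω) 0 k 0 < -(A + 1)} ≤
      ∫ ω, surf P (field ε ω) 0 (n + k) 0 ∂μ := by
  set X : Ω → ℝ := fun ω => (avg P)^[k] (surf P (field ε ω) 0 n) 0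
  set H : Ω → ℝ := fun ω => free P (field ε ω) n k 0
  have hXm : Measurable X := measurable_avg_iterate hP k (fun x => hε.measurable_surf hP 0 n x) 0
  have hHm : Measurable H := hε.measurable_free hP n k 0
  have hXi : Integrable X μ := hε.integrable_avg_iterate_surf hP n k
  have hHi : Integrable H μ := integrable_free hP (X := field ε) hε.integrable_noise n k 0
  have hind : IndepFun X H μ := hε.indepFun_avg_iterate_free hP n k
  have hAm : MeasurableSet {ω | X ω ≤ A} := measurableSet_le hXm measurable_const
  have hBm : MeasurableSet {ω | H ω < -(A + 1)} := measurableSet_lt hHm measurable_const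
  have h1 : μ.real {ω | free P (field ε ω) 0 k 0 < -(A + 1)} = μ.real {ω | H ω < -(A + 1)} :=
    congrArg ENNReal.toReal
      ((hε.identDistrib_free hP n k 0).measure_mem_eq (s := Set.Iio (-(A + 1)))
        measurableSet_Iio).symm
  have h2 : μ.real ({ω | X ω ≤ A} ∩ {ω | H ω < -(A + 1)}) =
      μ.real {ω | X ω ≤ A} * μ.real {ω | H ω < -(A + 1)} := by
    rw [measureReal_def, measureReal_def, measureReal_def, ← ENNReal.toReal_mul]
    exact congrArg ENNReal.toReal
      (hind.measure_inter_preimage_eq_mul (Set.Iic A) (Set.Iio (-(A + 1))) measurableSet_Iic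
        measurableSet_Iio)
  -- The indicator is the gain due to the wall: on that event `X + H + 1` is negative, hence below
  -- the wall surface; elsewhere `X + H` already is a lower bound.
  have h3 : ∫ ω, (X ω + H ω +
      ({ω | X ω ≤ A} ∩ {ω | H ω < -(A + 1)}).indicator (fun _ => (1 : ℝ)) ω) ∂μ =
      ∫ ω, surf P (field ε ω) 0 n 0 ∂μ +
        μ.real {ω | X ω ≤ A} * μ.real {ω | H ω < -(A + 1)} := by
    rw [integral_add (f := fun ω => X ω + H ω) (hXi.add hHi)
      ((integrable_const (1 : ℝ)).indicator (hAm.inter hBm)), integral_add hXi hHi,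
      hε.integral_avg_iterate_surf hP, hε.integral_free hP,
      integral_indicator_const _ (hAm.inter hBm), h2]
    simp
  rw [h1, ← h3]
  refine integral_mono ((hXi.add hHi).add
    ((integrable_const (1 : ℝ)).indicator (hAm.inter hBm))) (hε.integrable_surf hP 0 (n + k) 0) ?_
  intro ω
  have h4 := avg_iterate_add_free_le_surf hP (field ε ω) 0 n k 0
  rw [zero_add] at h4
  have h5 : 0 ≤ surf P (field ε ω) 0 (n + k) 0 := surf_nonneg _ _ _ _
  by_cases h : ω ∈ {ω | X ω ≤ A} ∩ {ω | H ω < -(A + 1)}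
  · simp only [Set.indicator_of_mem h]
    have ha : X ω ≤ A := h.1
    have hb : H ω < -(A + 1) := h.2
    linarith
  · simp only [Set.indicator_of_notMem h, add_zero]
    exact h4

/-- The mean height is unbounded. -/
lemma exists_lt_integral_surf (hP : IsHarnessMatrix P) (hε : IsSymmetricNoise μ ε)
    (hε0 : ¬ ∀ᵐ ω ∂μ, ε 0 0 ω = 0) (C : ℝ) :
    ∃ n : ℕ, C < ∫ ω, surf P (field ε ω) 0 n 0 ∂μ := by
  wlog hC : 0 < C generalizing C
  · obtain ⟨n, hn⟩ := this 1 one_pos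
    exact ⟨n, by linarith⟩
  by_contra! hcon
  obtain ⟨k, hk⟩ := hε.exists_measure_free_lt_pos hP hε0 (2 * C + 1)
  set p := μ.real {ω | free P (field ε ω) 0 k 0 < -(2 * C + 1)}
  have hp0 : 0 < p := ENNReal.toReal_pos hk.ne' (measure_ne_top _ _)
  -- Markov's inequality at twice the assumed bound `C` on the means.
  have hhalf : ∀ n : ℕ, 1 / 2 ≤ μ.real {ω | (avg P)^[k] (surf P (field ε ω) 0 n) 0 ≤ 2 * C} := by
    intro n
    have h1 := mul_meas_ge_le_integral_of_nonneg
      (ae_of_all μ fun ω => hP.avg_iterate_nonneg k (surf_nonneg (P := P) (field ε ω) 0 n) 0)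
      (hε.integrable_avg_iterate_surf hP n k) (2 * C)
    rw [hε.integral_avg_iterate_surf hP] at h1
    have h2 := measureReal_union_le (μ := μ)
      {ω | (avg P)^[k] (surf P (field ε ω) 0 n) 0 ≤ 2 * C}
      {ω | 2 * C ≤ (avg P)^[k] (surf P (field ε ω) 0 n) 0}
    have h3 : {ω | (avg P)^[k] (surf P (field ε ω) 0 n) 0 ≤ 2 * C} ∪
        {ω | 2 * C ≤ (avg P)^[k] (surf P (field ε ω) 0 n) 0} = Set.univ := by
      ext ω
      simp only [Set.mem_union, Set.mem_ofPred_eq, Set.mem_univ, iff_true]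
      exact le_total _ _
    rw [h3, probReal_univ] at h2
    have h4 : μ.real {ω | 2 * C ≤ (avg P)^[k] (surf P (field ε ω) 0 n) 0} ≤ 1 / 2 := by
      have := h1.trans (hcon n)
      by_contra! h
      nlinarith
    linarith
  -- Each block of `k` steps adds at least `1 / 2 * p` to the mean.
  have hgrow : ∀ r : ℕ, r * (p / 2) ≤ ∫ ω, surf P (field ε ω) 0 (r * k) 0 ∂μ := by
    intro r
    induction r with
    | zero => simp [surf]
    | succ r ih =>
      have h1 := hε.integral_surf_add_le hP (r * k) k (2 * C)
      have h2 : 1 / 2 * p ≤ _ := mul_le_mul_of_nonneg_right (hhalf (r * k)) hp0.le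
      rw [add_mul, one_mul]
      push_cast
      linarith
  obtain ⟨r, hr⟩ := exists_nat_gt (C / (p / 2))
  rw [div_lt_iff₀ (by positivity)] at hr
  linarith [hgrow r, hcon (r * k)]

/-- The truncated mean height is unbounded. -/
lemma exists_lt_integral_min_surf (hP : IsHarnessMatrix P) (hε : IsSymmetricNoise μ ε)
    (hε0 : ¬ ∀ᵐ ω ∂μ, ε 0 0 ω = 0) (C : ℝ) :
    ∃ (n : ℕ) (L : ℝ), 0 ≤ L ∧ C < ∫ ω, min (surf P (field ε ω) 0 n 0) L ∂μ := by
  obtain ⟨n, hn⟩ := hε.exists_lt_integral_surf hP hε0 C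
  have hlim : Tendsto (fun L : ℕ => ∫ ω, min (surf P (field ε ω) 0 n 0) L ∂μ) atTop
      (𝓝 (∫ ω, surf P (field ε ω) 0 n 0 ∂μ)) := by
    refine tendsto_integral_of_dominated_convergence (fun ω => surf P (field ε ω) 0 n 0)
      (fun L => ((hε.measurable_surf hP 0 n 0).min measurable_const).aestronglyMeasurable)
      (hε.integrable_surf hP 0 n 0) (fun L => ae_of_all _ fun ω => ?_) (ae_of_all _ fun ω => ?_)
    · rw [Real.norm_of_nonneg (le_min (surf_nonneg _ _ _ _) L.cast_nonneg)]
      exact min_le_left _ _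
    · obtain ⟨N, hN⟩ := exists_nat_ge (surf P (field ε ω) 0 n 0)
      refine tendsto_const_nhds.congr' ?_
      filter_upwards [eventually_ge_atTop N] with L hL
      exact (min_eq_left (hN.trans (by exact_mod_cast hL))).symm
  obtain ⟨L, hL⟩ := (hlim.eventually (lt_mem_nhds hn)).exists
  exact ⟨n, L, L.cast_nonneg, hL⟩

/-- Every level is exceeded with probability at least `1 / 3` at some time. -/
lemma exists_third_le_measureReal_surf (hd : 1 ≤ d) (hP : IsHarnessMatrix P)
    (hε : IsSymmetricNoise μ ε) (hε0 : ¬ ∀ᵐ ω ∂μ, ε 0 0 ω = 0) (M : ℝ) :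
    ∃ n : ℕ, 1 / 3 ≤ μ.real {ω | M < surf P (field ε ω) 0 n 0} := by
  -- The extra unit above `M` is the deviation used in Chebyshev's inequality.
  obtain ⟨n, L, hL0, hL⟩ := hε.exists_lt_integral_min_surf hP hε0 (M + 1)
  obtain ⟨R, hR⟩ := hP.exists_range
  have hfin : (Metric.closedBall (0 : Site d) (2 * R * n)).Finite :=
    (isCompact_closedBall _ _).finite_of_discrete
  set B := hfin.toFinset with hB
  -- The bound on the weights makes the variance at most 1/3; the added one keeps the denominator
  -- positive.
  obtain ⟨k, hk⟩ := hP.exists_weight_le hd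
    (show 0 < (1 / 3 : ℝ) / (B.card * L ^ 2 + 1) by positivity)
  obtain ⟨T, h0, -, h1, hz⟩ := hP.exists_avg_iterate_eq k
  set c := ∫ ω, min (surf P (field ε ω) 0 n 0) L ∂μ
  let Y : Site d → Ω → ℝ := fun x ω => min (surf P (field ε ω) 0 n x) L
  have hYm : ∀ x, Measurable (Y x) := fun x => (hε.measurable_surf hP 0 n x).min measurable_const
  have hYn : ∀ x ω, 0 ≤ Y x ω := fun x ω => le_min (surf_nonneg _ _ _ _) hL0
  have hYL : ∀ x ω, Y x ω ≤ L := fun x ω => min_le_right _ _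
  have hmin : Measurable fun t : ℝ => min t L := measurable_id.min measurable_const
  have hvar := integral_sq_weighted_sum_le (μ := μ) (c := c) (D := 2 * R * n) (B := B) hYm hYn hYL
    (fun x => ((hε.identDistrib_surf hP 0 n x).comp hmin).integral_eq)
    (fun x y hxy => (hε.indepFun_surf hP hR hxy).comp hmin hmin)
    (fun x hx => by simpa [hB] using hx) h0 h1 hk
  have hvar' : ∫ ω, (∑ x ∈ T, weight P k x * Y x ω - c) ^ 2 ∂μ ≤ 1 / 3 := by
    refine hvar.trans ?_
    have hpos : (0 : ℝ) < B.card * L ^ 2 + 1 := by positivity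
    rw [show (B.card : ℝ) * (1 / 3 / (B.card * L ^ 2 + 1)) * L ^ 2 =
      1 / 3 * ((B.card * L ^ 2) / (B.card * L ^ 2 + 1)) by ring]
    have : (B.card * L ^ 2 : ℝ) / (B.card * L ^ 2 + 1) ≤ 1 := by
      rw [div_le_one hpos]
      linarith
    linarith
  have hSm : Measurable fun ω => ∑ x ∈ T, weight P k x * Y x ω :=
    Finset.measurable_sum _ fun x _ => (hYm x).const_mul _
  have hSint : Integrable (fun ω => (∑ x ∈ T, weight P k x * Y x ω - c) ^ 2) μ := by
    refine Integrable.of_bound ((hSm.sub_const c).pow_const 2).aestronglyMeasurable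
      ((L + |c|) ^ 2) (ae_of_all _ fun ω => ?_)
    have hs0 : 0 ≤ ∑ x ∈ T, weight P k x * Y x ω :=
      Finset.sum_nonneg fun x _ => mul_nonneg (h0 x) (hYn x ω)
    have hsL : ∑ x ∈ T, weight P k x * Y x ω ≤ L := by
      calc ∑ x ∈ T, weight P k x * Y x ω ≤ ∑ x ∈ T, weight P k x * L :=
            Finset.sum_le_sum fun x _ => mul_le_mul_of_nonneg_left (hYL x ω) (h0 x)
        _ = L := by rw [← Finset.sum_mul, h1, one_mul]
    rw [Real.norm_of_nonneg (sq_nonneg _), ← sq_abs]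
    refine pow_le_pow_left₀ (abs_nonneg _) ?_ 2
    refine (abs_sub _ _).trans ?_
    rw [abs_of_nonneg hs0]
    linarith
  have hcheb := mul_meas_ge_le_integral_of_nonneg
    (ae_of_all μ fun ω => sq_nonneg (∑ x ∈ T, weight P k x * Y x ω - c)) hSint 1
  rw [one_mul] at hcheb
  -- If the averaged surface is at most `M`, so is its truncated version, which then deviates from
  -- `c > M + 1` by more than one.
  have hX : 2 / 3 ≤ μ.real {ω | M < (avg P)^[k] (surf P (field ε ω) 0 n) 0} := by
    have h2 := measureReal_union_le (μ := μ)
      {ω | M < (avg P)^[k] (surf P (field ε ω) 0 n) 0}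
      {ω | 1 ≤ (∑ x ∈ T, weight P k x * Y x ω - c) ^ 2}
    have h3 : {ω | M < (avg P)^[k] (surf P (field ε ω) 0 n) 0} ∪
        {ω | 1 ≤ (∑ x ∈ T, weight P k x * Y x ω - c) ^ 2} = Set.univ := by
      ext ω
      simp only [Set.mem_union, Set.mem_ofPred_eq, Set.mem_univ, iff_true]
      by_contra! h
      have h4 : ∑ x ∈ T, weight P k x * Y x ω ≤ M := by
        refine le_trans ?_ h.1
        rw [hz]
        refine Finset.sum_le_sum fun x _ => mul_le_mul_of_nonneg_left ?_ (h0 x)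
        rw [zero_add]
        exact min_le_left _ _
      nlinarith [h.2]
    rw [h3, probReal_univ] at h2
    linarith
  have hH := hε.half_le_measureReal_free_nonneg hP n k 0
  have hprod : μ.real ({ω | M < (avg P)^[k] (surf P (field ε ω) 0 n) 0} ∩
      {ω | 0 ≤ free P (field ε ω) n k 0}) =
      μ.real {ω | M < (avg P)^[k] (surf P (field ε ω) 0 n) 0} *
        μ.real {ω | 0 ≤ free P (field ε ω) n k 0} := by
    rw [measureReal_def, measureReal_def, measureReal_def, ← ENNReal.toReal_mul]
    exact congrArg ENNReal.toReal
      ((hε.indepFun_avg_iterate_free hP n k).measure_inter_preimage_eq_mul (Set.Ioi M) (Set.Ici 0)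
        measurableSet_Ioi measurableSet_Ici)
  refine ⟨n + k, ?_⟩
  calc (1 / 3 : ℝ) = 2 / 3 * (1 / 2) := by norm_num
    _ ≤ _ := mul_le_mul hX hH (by norm_num) measureReal_nonneg
    _ = _ := hprod.symm
    _ ≤ _ := by
      refine measureReal_mono fun ω hω => ?_
      have h2 := avg_iterate_add_free_le_surf hP (field ε ω) 0 n k 0
      rw [zero_add] at h2
      have ha : M < (avg P)^[k] (surf P (field ε ω) 0 n) 0 := hω.1
      have hb : 0 ≤ free P (field ε ω) n k 0 := hω.2
      simp only [Set.mem_ofPred_eq]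
      linarith

end IsSymmetricNoise

end SerialHarness

/-! ### Divergence from the remote past, and its consequences for heights and means. -/

namespace SerialHarness

variable {d : ℕ} {P : Site d → Site d → ℝ} {Ω : Type*}

/-- The event that the height at site `i` and time `t` diverges when the starting time is sent to
`-∞`. -/
def blowUp (P : Site d → Site d → ℝ) (ε : ℤ → Site d → Ω → ℝ) (t : ℤ) (i : Site d) : Set Ω :=
  {ω | ∀ M : ℕ, ∃ n, (M : ℝ) < backSurf P (field ε ω) t n i}

lemma mem_blowUp {ε : ℤ → Site d → Ω → ℝ} {t : ℤ} {i : Site d} {ω : Ω} :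
    ω ∈ blowUp P ε t i ↔ ∀ M : ℕ, ∃ n, (M : ℝ) < backSurf P (field ε ω) t n i := Iff.rfl

lemma tendsto_backSurf_of_mem_blowUp (hP : IsHarnessMatrix P) {ε : ℤ → Site d → Ω → ℝ} {t : ℤ}
    {i : Site d} {ω : Ω} (h : ω ∈ blowUp P ε t i) :
    Tendsto (fun n => backSurf P (field ε ω) t n i) atTop atTop := by
  refine tendsto_atTop_atTop_of_monotone (monotone_backSurf hP _ _ _) fun b => ?_
  obtain ⟨M, hM⟩ := exists_nat_ge b
  obtain ⟨n, hn⟩ := h M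
  exact ⟨n, hM.trans hn.le⟩

/-- A finite sum with positive weights diverges exactly when some term does, and the noise at time
`t` is finite, so it plays no role in the divergence. -/
lemma blowUp_eq_biUnion (hP : IsHarnessMatrix P) (ε : ℤ → Site d → Ω → ℝ) (t : ℤ) (i : Site d) :
    blowUp P ε t i = ⋃ x ∈ hP.steps, blowUp P ε (t - 1) (i + x) := by
  ext ω
  simp only [Set.mem_iUnion, exists_prop]
  constructor
  · intro h
    by_contra! hcon
    have hb : ∀ x, ∃ K : ℝ, ∀ n, x ∈ hP.steps → backSurf P (field ε ω) (t - 1) n (i + x) ≤ K := by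
      intro x
      by_cases hx : x ∈ hP.steps
      · have := hcon x hx
        rw [mem_blowUp] at this
        push Not at this
        obtain ⟨M, hM⟩ := this
        exact ⟨M, fun n _ => hM n⟩
      · exact ⟨0, fun n h => absurd h hx⟩
    choose K hK using hb
    obtain ⟨M, hM⟩ := exists_nat_ge (max (∑ x ∈ hP.steps, P 0 x * K x + ε t i ω) 0)
    obtain ⟨n, hn⟩ := h M
    cases n with
    | zero => exact absurd hn (not_lt.2 M.cast_nonneg)
    | succ n =>
      rw [backSurf_succ, wallStep_eq, hP.avg_eq_sum] at hn
      refine absurd (hM.trans_lt hn) (not_lt.2 (max_le_max_right _ (add_le_add_left ?_ _)))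
      exact Finset.sum_le_sum fun x hx => mul_le_mul_of_nonneg_left (hK x n hx) (hP.nonneg _ _)
  · rintro ⟨x, hx, h⟩ M
    have hpos : 0 < P 0 x := lt_of_le_of_ne (hP.nonneg _ _) (Ne.symm (hP.mem_steps.1 hx))
    have hlim := (tendsto_backSurf_of_mem_blowUp hP h).const_mul_atTop hpos
    obtain ⟨n, hn⟩ := (hlim.eventually (eventually_gt_atTop (M - ε t i ω))).exists
    refine ⟨n + 1, ?_⟩
    rw [backSurf_succ, wallStep_eq]
    refine lt_max_of_lt_left ?_
    have := hP.mul_le_avg (backSurf_nonneg (P := P) (field ε ω) (t - 1) n) i x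
    change _ < avg P _ i + ε t i ω
    linarith

/-- Applying `blowUp_eq_biUnion` `k` times discards the last `k` noise layers. As `k` is arbitrary,
the event is a tail event. -/
lemma measurableSet_blowUp (hP : IsHarnessMatrix P) (ε : ℤ → Site d → Ω → ℝ) (k : ℕ) (t : ℤ)
    (i : Site d) : MeasurableSet[noiseAlg ε {p | p.1 ≤ t - k}] (blowUp P ε t i) := by
  induction k generalizing t i with
  | zero =>
    have : blowUp P ε t i =
        ⋂ M : ℕ, ⋃ n : ℕ, {ω | (M : ℝ) < backSurf P (field ε ω) t n i} := by
      ext ω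
      simp [mem_blowUp]
    rw [this]
    refine MeasurableSet.iInter fun M => MeasurableSet.iUnion fun n => ?_
    refine measurableSet_lt (mδ := noiseAlg ε _) measurable_const
      (measurable_backSurf (mΩ := noiseAlg ε _) hP fun m j h => ?_)
    exact measurable_noiseAlg ε (by simpa using h)
  | succ k ih =>
    rw [blowUp_eq_biUnion hP]
    refine Finset.measurableSet_biUnion _ fun x _ => ?_
    have := ih (t - 1) (i + x)
    rwa [show t - 1 - (k : ℤ) = t - ((k + 1 : ℕ) : ℤ) by push_cast; ring] at this

namespace IsSymmetricNoise

variable [MeasurableSpace Ω] {μ : Measure Ω} {ε : ℤ → Site d → Ω → ℝ}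

/-- The divergence event belongs to the remote past of the noise. -/
lemma measure_blowUp_eq_zero_or_one [IsProbabilityMeasure μ] (hP : IsHarnessMatrix P)
    (hε : IsSymmetricNoise μ ε) (t : ℤ) (i : Site d) :
    μ (blowUp P ε t i) = 0 ∨ μ (blowUp P ε t i) = 1 := by
  -- Kolmogorov's zero-one law along times tending to `-∞`: the index sets `{k | n < k.1}` avoid the
  -- remote past and exhaust all indices as `n` decreases.
  refine measure_zero_or_one_of_measurableSet_limsup
    (s := fun k : ℤ × Site d => MeasurableSpace.comap (ε k.1 k.2) inferInstance)
    (f := comap Prod.fst atBot) (p := fun u => ∃ n : ℤ, u ⊆ {k | n < k.1})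
    (ns := fun n : ℤ => {k : ℤ × Site d | n < k.1})
    (fun k => (hε.measurable k.1 k.2).comap_le) hε.indep.iIndep ?_ ?_ (fun n => ⟨n, le_rfl⟩) ?_ ?_
  · rintro u ⟨n, hn⟩
    refine mem_comap.2 ⟨Set.Iic n, Iic_mem_atBot n, fun k hk hku => ?_⟩
    have h1 : n < k.1 := hn hku
    exact absurd h1 (not_lt.2 hk)
  · refine Antitone.directed_le fun a b hab k hk => ?_
    exact lt_of_le_of_lt hab hk
  · exact fun k => ⟨k.1 - 1, by simp⟩
  · rw [limsup_eq_iInf_iSup]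
    simp only [MeasurableSpace.measurableSet_iInf]
    intro u hu
    obtain ⟨v, hv, hvu⟩ := mem_comap.1 hu
    obtain ⟨a, ha⟩ := mem_atBot_sets.1 hv
    have hle : noiseAlg ε {p | p.1 ≤ t - ((t - a).toNat : ℕ)} ≤
        ⨆ k ∈ u, MeasurableSpace.comap (ε k.1 k.2) inferInstance := by
      refine biSup_mono fun k hk => hvu (ha _ ?_)
      simp only [Set.mem_ofPred_eq] at hk
      omega
    exact hle _ (measurableSet_blowUp hP ε _ t i)

lemma identDistrib_backSurf (hP : IsHarnessMatrix P) (hε : IsSymmetricNoise μ ε) (t : ℤ) (n : ℕ)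
    (i j : Site d) :
    IdentDistrib (fun ω => backSurf P (field ε ω) t n i)
      (fun ω => surf P (field ε ω) 0 n j) μ μ :=
  (hε.identDistrib_surf hP _ n i).trans (hε.identDistrib_surf hP 0 n j).symm

lemma measurable_backSurf (hP : IsHarnessMatrix P) (hε : IsSymmetricNoise μ ε) (t : ℤ) (n : ℕ)
    (i : Site d) : Measurable fun ω => backSurf P (field ε ω) t n i :=
  hε.measurable_surf hP _ n i

/-- Started from the remote past, the surface is almost surely infinite. -/
lemma ae_mem_blowUp [IsProbabilityMeasure μ] (hd : 1 ≤ d) (hP : IsHarnessMatrix P) (hε : IsSymmetricNoise μ ε)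
    (hε0 : ¬ ∀ᵐ ω ∂μ, ε 0 0 ω = 0) (t : ℤ) (i : Site d) : ∀ᵐ ω ∂μ, ω ∈ blowUp P ε t i := by
  let E : ℕ → Set Ω := fun M => ⋃ n : ℕ, {ω | (M : ℝ) < backSurf P (field ε ω) t n i}
  have hE : blowUp P ε t i = ⋂ M, E M := by
    ext ω
    simp [mem_blowUp, E]
  have hEm : ∀ M, MeasurableSet (E M) := fun M =>
    MeasurableSet.iUnion fun n => measurableSet_lt measurable_const
      (hε.measurable_backSurf hP t n i)
  have hEa : Antitone E := by
    intro a b hab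
    refine Set.iUnion_mono fun n ω hω => ?_
    have : (a : ℝ) ≤ b := by exact_mod_cast hab
    exact lt_of_le_of_lt this hω
  have hthird : ∀ M, ENNReal.ofReal (1 / 3) ≤ μ (E M) := by
    intro M
    obtain ⟨n, hn⟩ := hε.exists_third_le_measureReal_surf hd hP hε0 M
    calc ENNReal.ofReal (1 / 3) ≤ μ {ω | (M : ℝ) < surf P (field ε ω) 0 n 0} :=
          (ENNReal.ofReal_le_iff_le_toReal (measure_ne_top _ _)).2 hn
      _ = μ {ω | (M : ℝ) < backSurf P (field ε ω) t n i} :=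
          ((hε.identDistrib_backSurf hP t n i 0).measure_mem_eq (s := Set.Ioi (M : ℝ))
            measurableSet_Ioi).symm
      _ ≤ μ (E M) := measure_mono (Set.subset_iUnion (fun n => {ω | (M : ℝ) < backSurf P (field ε ω) t n i}) n)
  -- The bound 1/3 does not depend on `M`, so it survives the decreasing intersection.
  have hpos : ENNReal.ofReal (1 / 3) ≤ μ (blowUp P ε t i) := by
    rw [hE]
    exact ge_of_tendsto' (tendsto_measure_iInter_atTop (fun M => (hEm M).nullMeasurableSet) hEa
      ⟨0, measure_ne_top _ _⟩) hthird
  have hmeas : MeasurableSet (blowUp P ε t i) := by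
    rw [hE]
    exact MeasurableSet.iInter hEm
  have h1 : μ (blowUp P ε t i) = 1 := by
    refine (hε.measure_blowUp_eq_zero_or_one hP t i).resolve_left fun h => ?_
    rw [h] at hpos
    have : (0 : ENNReal) < ENNReal.ofReal (1 / 3) := ENNReal.ofReal_pos.2 (by norm_num)
    exact absurd hpos (not_le.2 this)
  exact (mem_ae_iff_prob_eq_one hmeas).2 h1

/-- Forward and backward surfaces have the same one-site laws, and the backward events increase to
one of full measure. -/
lemma tendsto_measure_lt_surf [IsProbabilityMeasure μ] (hd : 1 ≤ d) (hP : IsHarnessMatrix P) (hε : IsSymmetricNoise μ ε)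
    (hε0 : ¬ ∀ᵐ ω ∂μ, ε 0 0 ω = 0) (i : Site d) (M : ℝ) :
    Tendsto (fun n => μ {ω | M < surf P (field ε ω) 0 n i}) atTop (𝓝 1) := by
  have h1 : ∀ n, μ {ω | M < surf P (field ε ω) 0 n i} =
      μ {ω | M < backSurf P (field ε ω) 0 n i} := fun n =>
    ((hε.identDistrib_backSurf hP 0 n i i).measure_mem_eq (s := Set.Ioi M) measurableSet_Ioi).symm
  simp only [h1]
  have hmono : Monotone fun n => {ω | M < backSurf P (field ε ω) 0 n i} :=
    fun a b hab ω hω => lt_of_lt_of_le hω (monotone_backSurf hP _ _ _ hab)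
  have h2 : μ (⋃ n, {ω | M < backSurf P (field ε ω) 0 n i}) = 1 := by
    rw [← prob_compl_eq_zero_iff
      (MeasurableSet.iUnion fun n => measurableSet_lt measurable_const
        (hε.measurable_backSurf hP 0 n i)), ← mem_ae_iff]
    filter_upwards [hε.ae_mem_blowUp hd hP hε0 0 i] with ω hω
    obtain ⟨K, hK⟩ := exists_nat_ge M
    obtain ⟨n, hn⟩ := hω K
    exact Set.mem_iUnion.2 ⟨n, lt_of_le_of_lt hK hn⟩
  rw [← h2]
  exact tendsto_measure_iUnion_atTop hmono

/-- Forward surfaces need not be ordered in time, but the backward ones with the same means are. -/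
lemma monotone_integral_surf (hP : IsHarnessMatrix P) (hε : IsSymmetricNoise μ ε) :
    Monotone fun n => ∫ ω, surf P (field ε ω) 0 n 0 ∂μ := by
  intro a b hab
  simp only [← (hε.identDistrib_backSurf hP 0 _ 0 0).integral_eq]
  exact integral_mono (hε.integrable_surf hP _ a 0) (hε.integrable_surf hP _ b 0)
    fun ω => monotone_backSurf hP _ _ _ hab

lemma tendsto_integral_surf [IsProbabilityMeasure μ] (hP : IsHarnessMatrix P) (hε : IsSymmetricNoise μ ε)
    (hε0 : ¬ ∀ᵐ ω ∂μ, ε 0 0 ω = 0) :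
    Tendsto (fun n => ∫ ω, surf P (field ε ω) 0 n 0 ∂μ) atTop atTop :=
  tendsto_atTop_atTop_of_monotone (hε.monotone_integral_surf hP) fun b =>
    (hε.exists_lt_integral_surf hP hε0 b).imp fun _ h => h.le

/-- The increments of the mean height are the mean amounts removed by the wall. -/
lemma tendsto_integral_surf_succ_sub [IsProbabilityMeasure μ] (hd : 1 ≤ d) (hP : IsHarnessMatrix P)
    (hε : IsSymmetricNoise μ ε) (hε0 : ¬ ∀ᵐ ω ∂μ, ε 0 0 ω = 0) :
    Tendsto (fun n => ∫ ω, surf P (field ε ω) 0 (n + 1) 0 ∂μ - ∫ ω, surf P (field ε ω) 0 n 0 ∂μ)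
      atTop (𝓝 0) := by
  have hbi : ∀ t n i, Integrable (fun ω => backSurf P (field ε ω) t n i) μ :=
    fun t n i => hε.integrable_surf hP _ n i
  have havg : ∀ n, Integrable (fun ω => avg P (backSurf P (field ε ω) (0 - 1) n) 0) μ :=
    fun n => integrable_avg hP (hbi _ n) 0
  have hmean : ∫ ω, ε 0 0 ω ∂μ = 0 := by
    have := hε.symmetric.integral_eq
    rw [integral_neg] at this
    linarith
  have hinc : ∀ n, ∫ ω, surf P (field ε ω) 0 (n + 1) 0 ∂μ - ∫ ω, surf P (field ε ω) 0 n 0 ∂μ =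
      ∫ ω, max (-(avg P (backSurf P (field ε ω) (0 - 1) n) 0 + ε 0 0 ω)) 0 ∂μ := by
    intro n
    have h1 : ∫ ω, avg P (backSurf P (field ε ω) (0 - 1) n) 0 ∂μ =
        ∫ ω, surf P (field ε ω) 0 n 0 ∂μ := by
      simp only [hP.avg_eq_sum]
      rw [integral_finsetSum _ fun x _ => (hbi _ _ _).const_mul _]
      simp only [integral_const_mul, (hε.identDistrib_backSurf hP _ n _ 0).integral_eq]
      rw [← Finset.sum_mul, hP.sum_steps, one_mul]
    rw [← (hε.identDistrib_backSurf hP 0 (n + 1) 0 0).integral_eq, ← h1]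
    -- The identity `x⁻ = x⁺ - x`, with `x` the height before reflection.
    have h2 : ∀ ω, max (-(avg P (backSurf P (field ε ω) (0 - 1) n) 0 + ε 0 0 ω)) 0 =
        backSurf P (field ε ω) 0 (n + 1) 0 -
          avg P (backSurf P (field ε ω) (0 - 1) n) 0 - ε 0 0 ω := by
      intro ω
      rw [backSurf_succ, wallStep_eq]
      change _ = max (avg P _ 0 + ε 0 0 ω) 0 - _ - _
      rcases le_total (avg P (backSurf P (field ε ω) (0 - 1) n) 0 + ε 0 0 ω) 0 with h | h
      · rw [max_eq_left (by linarith), max_eq_right h]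
        ring
      · rw [max_eq_right (by linarith), max_eq_left h]
        ring
    simp only [h2]
    rw [integral_sub (f := fun ω => backSurf P (field ε ω) 0 (n + 1) 0 -
      avg P (backSurf P (field ε ω) (0 - 1) n) 0) ((hbi _ _ _).sub (havg n)) hε.integrable,
      integral_sub (hbi _ _ _) (havg n),
      hmean, sub_zero]
  simp only [hinc]
  suffices h : Tendsto (fun n => ∫ ω, max (-(avg P (backSurf P (field ε ω) (0 - 1) n) 0 +
      ε 0 0 ω)) 0 ∂μ) atTop (𝓝 (∫ _ : Ω, (0 : ℝ) ∂μ)) by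
    simpa using h
  -- The average is nonnegative, so the negative part is at most `|ε 0 0|`; it is eventually zero
  -- because a single diverging neighbour makes the average diverge.
  refine tendsto_integral_of_dominated_convergence (fun ω => |ε 0 0 ω|)
    (fun n => ((havg n).add hε.integrable).neg.pos_part.aestronglyMeasurable)
    hε.integrable.abs (fun n => ae_of_all _ fun ω => ?_) ?_
  · rw [Real.norm_of_nonneg (le_max_right _ _)]
    refine max_le ?_ (abs_nonneg _)
    have := hP.avg_nonneg (backSurf_nonneg (P := P) (field ε ω) (0 - 1) n) 0
    have := neg_abs_le (ε 0 0 ω)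
    linarith
  · obtain ⟨a, -, -, ha, -⟩ := hP.exists_ne_steps hd
    have hpos : 0 < P 0 a := lt_of_le_of_ne (hP.nonneg _ _) (Ne.symm ha)
    filter_upwards [hε.ae_mem_blowUp hd hP hε0 (0 - 1) (0 + a)] with ω hω
    have hlim := (tendsto_backSurf_of_mem_blowUp hP hω).const_mul_atTop hpos
    refine tendsto_const_nhds.congr' ?_
    filter_upwards [hlim.eventually (eventually_ge_atTop (-ε 0 0 ω))] with n hn
    have := hP.mul_le_avg (backSurf_nonneg (P := P) (field ε ω) (0 - 1) n) 0 a
    rw [max_eq_right]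
    linarith

lemma tendsto_integral_surf_div [IsProbabilityMeasure μ] (hd : 1 ≤ d) (hP : IsHarnessMatrix P)
    (hε : IsSymmetricNoise μ ε) (hε0 : ¬ ∀ᵐ ω ∂μ, ε 0 0 ω = 0) :
    Tendsto (fun n : ℕ => (∫ ω, surf P (field ε ω) 0 n 0 ∂μ) / (n : ℝ)) atTop (𝓝 0) := by
  have h := (hε.tendsto_integral_surf_succ_sub hd hP hε0).cesaro
  refine h.congr fun n => ?_
  rw [Finset.sum_range_sub (fun n => ∫ ω, surf P (field ε ω) 0 n 0 ∂μ)]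
  simp [surf, div_eq_inv_mul]

end IsSymmetricNoise

end SerialHarness

/-! ### Invariant measures: domination and nonexistence. -/

namespace SerialHarness

variable {d : ℕ} {P : Site d → Site d → ℝ}

lemma extWallStep_mono {z w : Site d → ENNReal} (h : z ≤ w) (e : Site d → ℝ) :
    extWallStep P z e ≤ extWallStep P w e := fun _ =>
  tsub_le_tsub_right (add_le_add_left
    (ENNReal.tsum_le_tsum fun j => mul_le_mul_right (h j) _) _) _

lemma measurable_extWallStep (P : Site d → Site d → ℝ) :
    Measurable fun q : (Site d → ENNReal) × (Site d → ℝ) => extWallStep P q.1 q.2 := by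
  refine measurable_pi_lambda _ fun i => ?_
  unfold extWallStep
  have h2 : Measurable fun q : (Site d → ENNReal) × (Site d → ℝ) => q.2 i :=
    (measurable_pi_apply i).comp measurable_snd
  exact ((Measurable.tsum fun j =>
    ((measurable_pi_apply j).comp measurable_fst).const_mul _).add h2.ennreal_ofReal).sub
      h2.neg.ennreal_ofReal

lemma measurable_wallStep (hP : IsHarnessMatrix P) :
    Measurable fun q : (Site d → ℝ) × (Site d → ℝ) => wallStep P q.1 q.2 := by
  refine measurable_pi_lambda _ fun i => ?_
  simp only [wallStep_eq]
  exact ((hP.measurable_avg fun x _ => (measurable_pi_apply _).comp measurable_fst).add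
    ((measurable_pi_apply i).comp measurable_snd)).max measurable_const

/-- The dynamics with infinite heights extends the one on finite nonnegative surfaces. -/
lemma extWallStep_ofReal (hP : IsHarnessMatrix P) {z : Site d → ℝ} (hz : ∀ i, 0 ≤ z i)
    (e : Site d → ℝ) :
    extWallStep P (fun i => ENNReal.ofReal (z i)) e =
      fun i => ENNReal.ofReal (wallStep P z e i) := by
  ext i
  have h1 : ∑' j, ENNReal.ofReal (P i j) * ENNReal.ofReal (z j) = ENNReal.ofReal (avg P z i) := by
    rw [hP.avg_eq_sum, ENNReal.ofReal_sum_of_nonneg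
      fun x _ => mul_nonneg (hP.nonneg _ _) (hz _), ← (Equiv.addLeft i).tsum_eq,
      tsum_eq_sum (s := hP.steps)]
    · exact Finset.sum_congr rfl fun x _ => by
        rw [Equiv.coe_addLeft, hP.apply_add, ENNReal.ofReal_mul (hP.nonneg _ _)]
    · intro x hx
      have : P 0 x = 0 := by simpa [hP.mem_steps] using hx
      simp [hP.apply_add, this]
  have hA := hP.avg_nonneg hz i
  rw [extWallStep, h1, wallStep_eq]
  rcases le_total 0 (e i) with h | h
  · rw [← ENNReal.ofReal_add hA h, ENNReal.ofReal_of_nonpos (neg_nonpos.2 h), tsub_zero,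
      max_eq_left (add_nonneg hA h)]
  · rw [ENNReal.ofReal_of_nonpos h, add_zero, ← ENNReal.ofReal_sub _ (neg_nonneg.2 h),
      sub_neg_eq_add, ENNReal.ofReal_max, ENNReal.ofReal_zero, max_eq_left zero_le]

/-- An invariant measure on finite surfaces is one on surfaces with possibly infinite heights. -/
lemma IsInvariantMeasure.isExtInvariantMeasure (hP : IsHarnessMatrix P)
    {κ ν : Measure (Site d → ℝ)} [IsProbabilityMeasure κ] (h : IsInvariantMeasure P κ ν) :
    IsExtInvariantMeasure P κ (ν.map fun z i => ENNReal.ofReal (z i)) := by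
  obtain ⟨hν, hinv⟩ := h
  have hφ : Measurable fun (z : Site d → ℝ) (i : Site d) => ENNReal.ofReal (z i) :=
    measurable_pi_lambda _ fun i => (measurable_pi_apply i).ennreal_ofReal
  refine ⟨Measure.isProbabilityMeasure_map hφ.aemeasurable, ?_⟩
  -- By invariance `ν` is a law of positive parts, so `ENNReal.ofReal` loses nothing almost surely.
  have hnn : ∀ᵐ z ∂ν, ∀ i, 0 ≤ z i := by
    rw [← hinv, ae_all_iff]
    intro i
    rw [ae_map_iff (measurable_wallStep hP).aemeasurable
      (measurableSet_le measurable_const (measurable_pi_apply i))]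
    exact ae_of_all _ fun q => wallStep_nonneg _ _ i
  have h1 : (ν.map fun z i => ENNReal.ofReal (z i)).prod κ =
      (ν.prod κ).map (Prod.map (fun z i => ENNReal.ofReal (z i)) id) := by
    rw [← Measure.map_prod_map ν κ hφ measurable_id, Measure.map_id]
  rw [h1, Measure.map_map (measurable_extWallStep P) (hφ.prodMap measurable_id)]
  have h2 : (fun q => extWallStep P q.1 q.2) ∘
      (Prod.map (fun (z : Site d → ℝ) (i : Site d) => ENNReal.ofReal (z i)) id) =ᵐ[ν.prod κ]
      (fun z i => ENNReal.ofReal (z i)) ∘ fun q => wallStep P q.1 q.2 := by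
    have hq : ∀ᵐ q ∂ν.prod κ, ∀ i, 0 ≤ q.1 i :=
      Measure.quasiMeasurePreserving_fst.ae hnn
    filter_upwards [hq] with q hq
    exact extWallStep_ofReal hP hq q.2
  rw [Measure.map_congr h2, ← Measure.map_map hφ (measurable_wallStep hP), hinv]

namespace IsSymmetricNoise

variable {Ω : Type*} [MeasurableSpace Ω] {μ : Measure Ω} {ε : ℤ → Site d → Ω → ℝ}

lemma map_noise_eq_noiseLaw (hε : IsSymmetricNoise μ ε) (m : ℤ) :
    μ.map (fun ω j => ε m j ω) = noiseLaw μ ε := by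
  have := (hε.identDistrib_shift m 0).comp (measurable_pi_apply (0 : ℤ))
  simpa [Function.comp_def, noiseLaw] using this.map_eq

lemma measurable_noise_at (hε : IsSymmetricNoise μ ε) (m : ℤ) : Measurable fun ω j => ε m j ω :=
  measurable_pi_lambda _ fun j => hε.measurable m j

variable [IsProbabilityMeasure μ]

lemma isProbabilityMeasure_noiseLaw (hε : IsSymmetricNoise μ ε) :
    IsProbabilityMeasure (noiseLaw μ ε) :=
  Measure.isProbabilityMeasure_map (hε.measurable_noise_at 0).aemeasurable

/-- Every invariant measure dominates the law of the surface started flat at height zero. -/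
lemma lintegral_surf_le (hP : IsHarnessMatrix P) (hε : IsSymmetricNoise μ ε)
    {ν : Measure (Site d → ENNReal)} (hν : IsExtInvariantMeasure P (noiseLaw μ ε) ν) (n : ℕ)
    {f : (Site d → ENNReal) → ENNReal} (hf : Monotone f) (hfm : Measurable f) :
    ∫⁻ ω, f (fun i => ENNReal.ofReal (surf P (field ε ω) 0 n i)) ∂μ ≤ ∫⁻ z, f z ∂ν := by
  have := hε.isProbabilityMeasure_noiseLaw
  obtain ⟨hν1, hinv⟩ := hν
  -- The test function must vary: the induction step applies the hypothesis to `f` composed with one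
  -- step of frozen noise, which is again monotone.
  induction n generalizing f with
  | zero =>
    calc ∫⁻ ω, f (fun i => ENNReal.ofReal (surf P (field ε ω) 0 0 i)) ∂μ
        = f 0 := by simp [surf, Pi.zero_def]
      _ = ∫⁻ _, f 0 ∂ν := by simp
      _ ≤ ∫⁻ z, f z ∂ν := lintegral_mono fun z => hf fun _ => zero_le
  | succ n ih =>
    let Z : Ω → Site d → ENNReal := fun ω i => ENNReal.ofReal (surf P (field ε ω) 0 n i)
    let e : Ω → Site d → ℝ := fun ω j => ε (0 + n + 1) j ω
    have hZm : Measurable Z :=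
      measurable_pi_lambda _ fun i => (hε.measurable_surf hP 0 n i).ennreal_ofReal
    have hem : Measurable e := hε.measurable_noise_at _
    have hind : IndepFun Z e μ := by
      refine hε.indepFun (S := {p | p.1 ≤ (n : ℤ)}) (T := {p | (n : ℤ) < p.1}) ?_ ?_ ?_
      · rw [Set.disjoint_left]
        intro p h1 h2
        simp only [Set.mem_ofPred_eq] at h1 h2
        omega
      · refine @measurable_pi_lambda _ _ _ (noiseAlg ε _) _ _ fun i =>
          ENNReal.measurable_ofReal.comp ?_
        refine SerialHarness.measurable_surf (mΩ := noiseAlg ε _) hP fun m j _ h => ?_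
        exact measurable_noiseAlg ε (by simpa using h)
      · exact @measurable_pi_lambda _ _ _ (noiseAlg ε _) _ _ fun j =>
          measurable_noiseAlg ε (by simp)
    have hstep : ∀ ω, (fun i => ENNReal.ofReal (surf P (field ε ω) 0 (n + 1) i)) =
        extWallStep P (Z ω) (e ω) := fun ω =>
      (extWallStep_ofReal hP (surf_nonneg (P := P) (field ε ω) 0 n) (e ω)).symm
    have hFm : Measurable fun q : (Site d → ENNReal) × (Site d → ℝ) =>
        f (extWallStep P q.1 q.2) := hfm.comp (measurable_extWallStep P)
    have hlaw : μ.map (fun ω => (Z ω, e ω)) = (μ.map Z).prod (noiseLaw μ ε) := by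
      rw [(indepFun_iff_map_prod_eq_prod_map_map hZm.aemeasurable hem.aemeasurable).1 hind,
        hε.map_noise_eq_noiseLaw]
    have := Measure.isProbabilityMeasure_map (μ := μ) hZm.aemeasurable
    calc ∫⁻ ω, f (fun i => ENNReal.ofReal (surf P (field ε ω) 0 (n + 1) i)) ∂μ
        = ∫⁻ q, f (extWallStep P q.1 q.2) ∂(μ.map Z).prod (noiseLaw μ ε) := by
          simp only [hstep]
          rw [← hlaw, lintegral_map hFm (hZm.prodMk hem)]
      _ = ∫⁻ y, ∫⁻ z, f (extWallStep P z y) ∂(μ.map Z) ∂noiseLaw μ ε :=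
          lintegral_prod_symm _ hFm.aemeasurable
      _ ≤ ∫⁻ y, ∫⁻ z, f (extWallStep P z y) ∂ν ∂noiseLaw μ ε := by
          refine lintegral_mono fun y => ?_
          have hy : Measurable fun z => f (extWallStep P z y) :=
            hFm.comp (measurable_id.prodMk measurable_const)
          rw [lintegral_map hy hZm]
          exact ih (fun z w h => hf (extWallStep_mono h y)) hy
      _ = ∫⁻ q, f (extWallStep P q.1 q.2) ∂ν.prod (noiseLaw μ ε) :=
          (lintegral_prod_symm _ hFm.aemeasurable).symm
      _ = ∫⁻ z, f z ∂ν := by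
          rw [← lintegral_map hfm (measurable_extWallStep P), hinv]

/-- Domination is applied to the increasing indicator of a height above `M`, whose expectation under
the flat start tends to one. -/
lemma ae_eq_top_of_isExtInvariantMeasure (hd : 1 ≤ d) (hP : IsHarnessMatrix P)
    (hε : IsSymmetricNoise μ ε) (hε0 : ¬ ∀ᵐ ω ∂μ, ε 0 0 ω = 0)
    {ν : Measure (Site d → ENNReal)} (hν : IsExtInvariantMeasure P (noiseLaw μ ε) ν) :
    ∀ᵐ z ∂ν, ∀ i, z i = ⊤ := by
  have hν1 := hν.1
  have key : ∀ (i : Site d) (M : ℕ), ∀ᵐ z ∂ν, (M : ENNReal) < z i := by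
    intro i M
    have hA : MeasurableSet {z : Site d → ENNReal | (M : ENNReal) < z i} :=
      measurableSet_lt measurable_const (measurable_pi_apply i)
    refine (mem_ae_iff_prob_eq_one hA).2 (le_antisymm prob_le_one ?_)
    refine le_of_tendsto' (hε.tendsto_measure_lt_surf hd hP hε0 i M) fun n => ?_
    have hm : Monotone ({z : Site d → ENNReal | (M : ENNReal) < z i}.indicator
        (1 : (Site d → ENNReal) → ENNReal)) := by
      intro z w h
      simp only [Set.indicator_apply, Set.mem_ofPred_eq, Pi.one_apply]
      split_ifs with hz hw
      · exact le_rfl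
      · exact absurd (hz.trans_le (h i)) hw
      · exact zero_le
      · exact le_rfl
    have h1 := hε.lintegral_surf_le hP hν n hm (measurable_one.indicator hA)
    rw [lintegral_indicator_one hA] at h1
    refine le_trans (le_of_eq ?_) h1
    rw [← lintegral_indicator_one (measurableSet_lt measurable_const (hε.measurable_surf hP 0 n i))]
    refine lintegral_congr fun ω => ?_
    simp only [Set.indicator_apply, Set.mem_ofPred_eq]
    congr 1
    rw [← ENNReal.ofReal_natCast, ENNReal.ofReal_lt_ofReal_iff_of_nonneg M.cast_nonneg]
  rw [ae_all_iff]
  intro i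
  filter_upwards [ae_all_iff.2 (key i)] with z hz
  exact ENNReal.eq_top_of_forall_nnreal_le fun r => by
    obtain ⟨M, hM⟩ := exists_nat_ge r
    exact le_trans (by exact_mod_cast hM) (hz M).le

/-- Pushed to extended heights, such a law would be carried by the infinite surface, yet its heights
are finite. -/
lemma not_isInvariantMeasure (hd : 1 ≤ d) (hP : IsHarnessMatrix P)
    (hε : IsSymmetricNoise μ ε) (hε0 : ¬ ∀ᵐ ω ∂μ, ε 0 0 ω = 0) (ν : Measure (Site d → ℝ)) :
    ¬ IsInvariantMeasure P (noiseLaw μ ε) ν := by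
  intro h
  have := hε.isProbabilityMeasure_noiseLaw
  have hν := h.1
  have h1 := hε.ae_eq_top_of_isExtInvariantMeasure hd hP hε0 (h.isExtInvariantMeasure hP)
  have hφ : Measurable fun (z : Site d → ℝ) (i : Site d) => ENNReal.ofReal (z i) :=
    measurable_pi_lambda _ fun i => (measurable_pi_apply i).ennreal_ofReal
  obtain ⟨z, hz⟩ := (ae_of_ae_map hφ.aemeasurable h1).exists
  exact ENNReal.ofReal_ne_top (hz 0)

end IsSymmetricNoise

end SerialHarness

theorem theorem1 {d : ℕ} (hd : 1 ≤ d)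
    (P : SerialHarness.Site d → SerialHarness.Site d → ℝ) (hP : SerialHarness.IsHarnessMatrix P)
    {Ω : Type*} [MeasurableSpace Ω] (μ : Measure Ω) [IsProbabilityMeasure μ]
    (ε : ℤ → SerialHarness.Site d → Ω → ℝ) (hε : SerialHarness.IsSymmetricNoise μ ε)
    (hε0 : ¬ ∀ᵐ ω ∂μ, ε 0 0 ω = 0) :
    -- (a) no invariant measure on finite surfaces; with infinite heights allowed, the only
    -- possible one is carried by the surface that is identically infinite
    ((¬ ∃ ν : Measure (SerialHarness.Site d → ℝ),
        SerialHarness.IsInvariantMeasure P (SerialHarness.noiseLaw μ ε) ν) ∧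
      ∀ ν : Measure (SerialHarness.Site d → ENNReal),
        SerialHarness.IsExtInvariantMeasure P (SerialHarness.noiseLaw μ ε) ν →
          ∀ᵐ z ∂ν, ∀ i, z i = ⊤) ∧
    -- (b) convergence to infinity in probability
    (∀ (i : SerialHarness.Site d) (M : ℝ),
      Tendsto (fun n : ℕ => μ {ω | M < SerialHarness.wallProcess P ε n i ω}) atTop (𝓝 1)) ∧
    -- the heights have finite means
    (∀ (n : ℕ) (i : SerialHarness.Site d),
      Integrable (fun ω => SerialHarness.wallProcess P ε n i ω) μ) ∧
    -- (c) the mean height diverges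
    Tendsto (fun n : ℕ => ∫ ω, SerialHarness.wallProcess P ε n 0 ω ∂μ) atTop atTop ∧
    -- (d) the mean height is sublinear
    Tendsto (fun n : ℕ => (∫ ω, SerialHarness.wallProcess P ε n 0 ω ∂μ) / (n : ℝ)) atTop (𝓝 0) := by
  simp only [SerialHarness.wallProcess_eq_surf]
  exact ⟨⟨fun ⟨ν, hν⟩ => hε.not_isInvariantMeasure hd hP hε0 ν hν,
      fun ν hν => hε.ae_eq_top_of_isExtInvariantMeasure hd hP hε0 hν⟩,
    hε.tendsto_measure_lt_surf hd hP hε0, hε.integrable_surf hP 0,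
    hε.tendsto_integral_surf hP hε0, hε.tendsto_integral_surf_div hd hP hε0⟩
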